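/- \textbf{Setting.} A setting $(N,M,\mathbf q)$ consists of a finite set $N$ of $n$ agents, a finite set $M$ of $m$ objects and capacities $q_j\in\mathbb N$, $j\in M$, with $n\le\sum_{j\in M} q_j$. A type $t$ is a strict total order on $M$ (identified with the set of utility functions $u:M\to\mathbb R$ such that $u(a)>u(b)$ if and only if $a$ is preferred to $b$ under $t$), and $T$ is the set of types. An allocation is a matrix $x\in[0,1]^{N\times M}$ with $\sum_j x_{i,j}=1$ for all $i$ and $\sum_i x_{i,j}\le q_j$ for all $j$. A mechanism $f$ maps each type profile $\mathbf t=(t_i,t_{-i})\in T^n$ to an allocation $f(\mathbf t)$, and $f_i(\mathbf t)$ is the row of agent $i$. For $\beta\in[0,1]$ the hybrid is $h_\beta(f,g)=(1-\beta)f+\beta g$; it is non-trivial if $\beta\in(0,1)$. \textbf{Incentives.} $f$ is strategyproof if $\langle u_i, f_i(t_i,t_{-i})-f_i(t_i',t_{-i})\rangle\ge 0$ for all $i$, all $(t_i,t_{-i})\in T^n$, all $t_i'\in T$ and all $u_i\in t_i$. It is $\mathrm{URBI}(r)$-partially strategyproof if this holds for all those $u_i\in t_i$ that satisfy $\mathrm{URBI}(r)$,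 i.e., $r\,(u(a)-\min u)\ge u(b)-\min u$ whenever $u(a)>u(b)$. Types are neighbors if they differ by a swap of two objects of adjacent ranks. $g$ is weakly invariant if, whenever an agent $i$ changes its report from $t_i$ to a neighbor $t_i'$ by swapping adjacent objects $a\succ b$, its probability of each object that it strictly prefers to $a$ is unchanged. $g$ is weakly less varying than $f$ if, for neighbors $t_i,t_i'$, $g_i(t_i,t_{-i})\ne g_i(t_i',t_{-i})$ implies $f_i(t_i,t_{-i})\neq f_i(t_i',t_{-i})$. The pair $(f,g)$ is hybrid-admissible if $f$ is strategyproof and $g$ is weakly invariant and weakly less varying than $f$. \textbf{Efficiency.} $x$ ordinally dominates $y$ at $\mathbf t$ if $\sum_{j\succ_i b}x_{i,j}\ge\sum_{j\succ_i b}y_{i,j}$ for all agents $i$ and all objects $b$, and strictly so if one of these inequalities is strict. $g$ (weakly) imperfectly ordinally dominates $f$ if $g(\mathbf t)$ ordinally dominates $f(\mathbf t)$ at every $\mathbf t$ at which one of the two allocations ordinally dominates the other; it strictly imperfectly ordinally dominates $f$ if in addition $g(\mathbf t)$ strictly ordinally dominates $f(\mathbf t)$ for some $\mathbf t$. \textbf{Mechanisms.}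 $\mathrm{RSD}$ (Random Serial Dictatorship) draws one of the $n!$ orderings of the agents uniformly at random and lets the agents pick, in this order, their most preferred object among those with remaining capacity. $\mathrm{PS}$ (Probabilistic Serial) lets all agents eat simultaneously, at unit speed from time $0$ to time $1$, from their most preferred object that is not yet exhausted, where $q_j$ units of object $j$ are available at time $0$; the probabilities are the shares eaten at time $1$. \textbf{Claim.} In every setting: (1) the pair $(\mathrm{RSD},\mathrm{PS})$ is hybrid-admissible; (2) for every $\beta\in(0,1]$, $h_\beta(\mathrm{RSD},\mathrm{PS})$ imperfectly ordinally dominates $\mathrm{RSD}$, and it does so strictly if $\mathrm{PS}(\mathbf t)$ strictly ordinally dominates $\mathrm{RSD}(\mathbf t)$ for some type profile $\mathbf t$ of the setting; (3) for every $r\in[0,1)$ there is $\beta\in(0,1)$ such that $h_\beta(\mathrm{RSD},\mathrm{PS})$ is $\mathrm{URBI}(r)$-partially strategyproof and imperfectly ordinally dominates $\mathrm{RSD}$. Moreover, (4) there is a setting in which $\mathrm{PS}$ strictly imperfectly ordinally dominates $\mathrm{RSD}$ and in which for every $r\in[0,1)$ there is $\beta\in(0,1)$ such that $h_\beta(\mathrm{RSD},\mathrm{PS})$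 is $\mathrm{URBI}(r)$-partially strategyproof and strictly imperfectly ordinally dominates $\mathrm{RSD}$. -/

import Mathlib

open scoped BigOperators

noncomputable section

/-- A setting: agents `N`, objects `M`, capacities `cap`, with supply at least demand. -/
structure Setting (N M : Type*) [Fintype N] [Fintype M] where
  cap : M → ℕ
  supply : Fintype.card N ≤ ∑ j, cap j

/-- A strict preference ordering of the finite set `M`, given by the rank of each object:
rank `0` is the first choice, and `a` is strictly preferred to `b` iff `t a < t b`. -/
abbrev Pref (M : Type*) [Fintype M] := M ≃ Fin (Fintype.card M)

/-- `a` is strictly preferred to `b` under `t`. -/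
def Pref.Prefers {M : Type*} [Fintype M] (t : Pref M) (a b : M) : Prop := t a < t b

/-- The utility `u` (without indifferences) belongs to the type `t`. -/
def Pref.Consistent {M : Type*} [Fintype M] (t : Pref M) (u : M → ℝ) : Prop :=
  ∀ a b, t.Prefers a b ↔ u b < u a

/-- `t'` arises from `t` by swapping the objects `a` and `b`, where `b` is ranked directly
below `a` under `t`. -/
def Pref.IsAdjacentSwap {M : Type*} [Fintype M] [DecidableEq M] (t t' : Pref M) (a b : M) : Prop :=
  (t b : ℕ) = (t a : ℕ) + 1 ∧ t' = (Equiv.swap a b).trans t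

/-- The neighborhood of `t`: all types that differ from `t` by one swap of adjacent objects. -/
def Pref.neighborhood {M : Type*} [Fintype M] [DecidableEq M] (t : Pref M) : Set (Pref M) :=
  {t' | ∃ a b, t.IsAdjacentSwap t' a b}

/-- A (probabilistic) allocation: agent `i` gets object `j` with probability `prob i j`. -/
@[ext]
structure Allocation {N M : Type*} [Fintype N] [Fintype M] (S : Setting N M) where
  prob : N → M → ℝ
  mem_Icc : ∀ i j, prob i j ∈ Set.Icc (0 : ℝ) 1
  fulfillment : ∀ i, ∑ j, prob i j = 1
  capacity : ∀ j, ∑ i, prob i j ≤ S.cap j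

/-- An (ordinal) mechanism maps profiles of preference orderings to allocations. -/
abbrev Mechanism {N M : Type*} [Fintype N] [Fintype M] (S : Setting N M) :=
  (N → Pref M) → Allocation S

section Properties

variable {N M : Type*} [Fintype N] [Fintype M] [DecidableEq N] [DecidableEq M] {S : Setting N M}

/-- Truthful reporting maximizes expected utility, for all consistent utilities. -/
def Mechanism.Strategyproof (f : Mechanism S) : Prop :=
  ∀ (i : N) (t : N → Pref M) (t' : Pref M) (u : M → ℝ), (t i).Consistent u →
    0 ≤ ∑ j, u j * ((f t).prob i j - (f (Function.update t i t')).prob i j)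

/-- Uniformly relatively bounded indifference with bound `r`; `⨅ c, u c` is the minimum of `u`. -/
def URBI (r : ℝ) (u : M → ℝ) : Prop :=
  ∀ a b, u b < u a → u b - (⨅ c, u c) ≤ r * (u a - ⨅ c, u c)

/-- `URBI(r)`-partial strategyproofness. -/
def Mechanism.PartiallyStrategyproof (r : ℝ) (f : Mechanism S) : Prop :=
  ∀ (i : N) (t : N → Pref M) (t' : Pref M) (u : M → ℝ), (t i).Consistent u → URBI r u →
    0 ≤ ∑ j, u j * ((f t).prob i j - (f (Function.update t i t')).prob i j)

/-- If an agent swaps the adjacent objects `a` and `b`, then its probabilities for the objects that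
it strictly prefers to `a` do not change. -/
def Mechanism.WeaklyInvariant (f : Mechanism S) : Prop :=
  ∀ (i : N) (t : N → Pref M) (t' : Pref M) (a b : M), (t i).IsAdjacentSwap t' a b →
    ∀ j, (t i).Prefers j a → (f t).prob i j = (f (Function.update t i t')).prob i j

/-- `g` is weakly less varying than `f`. -/
def Mechanism.WeaklyLessVarying (g f : Mechanism S) : Prop :=
  ∀ (i : N) (t : N → Pref M) (t' : Pref M), t' ∈ (t i).neighborhood →
    (g t).prob i ≠ (g (Function.update t i t')).prob i →
    (f t).prob i ≠ (f (Function.update t i t')).prob i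

/-- The pair `(f, g)` is hybrid-admissible. -/
structure HybridAdmissible (f g : Mechanism S) : Prop where
  strategyproof : f.Strategyproof
  weaklyInvariant : g.WeaklyInvariant
  weaklyLessVarying : g.WeaklyLessVarying f

end Properties

section Dominance

variable {N M : Type*} [Fintype N] [Fintype M] {S : Setting N M}

open Classical in
/-- The total weight under `v` of the objects that `t` strictly prefers to `b`. -/
def upperWeight (t : Pref M) (v : M → ℝ) (b : M) : ℝ :=
  ∑ j ∈ Finset.univ.filter (fun j => t.Prefers j b), v j

/-- The allocation vector `v` first order-stochastically dominates `w` for the type `t`. -/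
def FOSD (t : Pref M) (v w : M → ℝ) : Prop :=
  ∀ b, upperWeight t w b ≤ upperWeight t v b

/-- `x` (weakly) ordinally dominates `y` at the type profile `t`. -/
def OrdDominates (t : N → Pref M) (x y : Allocation S) : Prop :=
  ∀ i, FOSD (t i) (x.prob i) (y.prob i)

/-- `x` strictly ordinally dominates `y` at the type profile `t`. -/
def StrictOrdDominates (t : N → Pref M) (x y : Allocation S) : Prop :=
  OrdDominates t x y ∧
    ∃ i b, upperWeight (t i) (y.prob i) b < upperWeight (t i) (x.prob i) b

/-- `g` weakly imperfectly ordinally dominates `f`: it ordinally dominates `f` at every type profile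
where the two allocations are comparable by ordinal dominance. -/
def ImperfectOrdDominates (g f : Mechanism S) : Prop :=
  ∀ t, OrdDominates t (g t) (f t) ∨ OrdDominates t (f t) (g t) → OrdDominates t (g t) (f t)

/-- `g` strictly imperfectly ordinally dominates `f`. -/
def StrictImperfectOrdDominates (g f : Mechanism S) : Prop :=
  ImperfectOrdDominates g f ∧ ∃ t, StrictOrdDominates t (g t) (f t)

end Dominance

section Hybrid

variable {N M : Type*} [Fintype N] [Fintype M] {S : Setting N M}

/-- The convex combination `(1 - β) x + β y` of two allocations. -/
def Allocation.mix (β : ℝ) (hβ : β ∈ Set.Icc (0 : ℝ) 1) (x y : Allocation S) : Allocation S where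
  prob i j := (1 - β) * x.prob i j + β * y.prob i j
  mem_Icc i j := by
    have h := convex_Icc (0 : ℝ) 1 (x.mem_Icc i j) (y.mem_Icc i j)
      (sub_nonneg.2 hβ.2) hβ.1 (by ring)
    simpa [smul_eq_mul] using h
  fulfillment i := by
    rw [Finset.sum_add_distrib, ← Finset.mul_sum, ← Finset.mul_sum, x.fulfillment, y.fulfillment]
    ring
  capacity j := by
    rw [Finset.sum_add_distrib, ← Finset.mul_sum, ← Finset.mul_sum]
    have h1 := mul_le_mul_of_nonneg_left (x.capacity j) (sub_nonneg.2 hβ.2)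
    have h2 := mul_le_mul_of_nonneg_left (y.capacity j) hβ.1
    linarith

/-- The `β`-hybrid of the mechanisms `f` and `g`. -/
def hybrid (β : ℝ) (hβ : β ∈ Set.Icc (0 : ℝ) 1) (f g : Mechanism S) : Mechanism S :=
  fun t => Allocation.mix β hβ (f t) (g t)

end Hybrid

section Favorite

variable {M : Type*} [Fintype M]

/-- `j` is the most preferred object in the set `A` under `t`. -/
def IsFavorite (t : Pref M) (A : Set M) (j : M) : Prop :=
  j ∈ A ∧ ∀ k ∈ A, t j ≤ t k

theorem IsFavorite.eq {t : Pref M} {A : Set M} {j k : M}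
    (hj : IsFavorite t A j) (hk : IsFavorite t A k) : j = k :=
  t.injective (le_antisymm (hj.2 k hk.1) (hk.2 j hj.1))

theorem IsFavorite.exists (t : Pref M) {A : Set M} (hA : A.Nonempty) : ∃ j, IsFavorite t A j := by
  classical
  obtain ⟨j, hj, hmin⟩ := Set.exists_min_image A t (Set.toFinite A) hA
  exact ⟨j, hj, hmin⟩

open Classical in
theorem IsFavorite.sum_ite (t : Pref M) {A : Set M} (hA : A.Nonempty) (c : ℝ) :
    ∑ j, (if IsFavorite t A j then c else 0) = c := by
  obtain ⟨j, hj⟩ := IsFavorite.exists t hA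
  rw [Finset.sum_eq_single j]
  · simp [hj]
  · intro k _ hk
    exact if_neg fun h => hk (h.eq hj)
  · simp

end Favorite

section RSD

variable {N M : Type*} [Fintype N] [Fintype M]

open Classical in
/-- The capacities that remain after the first `k` agents in the ordering `π` have picked, one after
the other, their most preferred object among those with remaining capacity. -/
def remainingCap (S : Setting N M) (t : N → Pref M) (π : Fin (Fintype.card N) ≃ N) : ℕ → M → ℕ
  | 0 => S.cap
  | k + 1 => fun j =>
      if ∃ h : k < Fintype.card N,
          IsFavorite (t (π ⟨k, h⟩)) {a | 0 < remainingCap S t π k a} j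
      then remainingCap S t π k j - 1 else remainingCap S t π k j

open Classical in
/-- The deterministic assignment of the serial dictatorship with ordering `π`, as a 0/1-matrix:
agent `i` gets its most preferred object among those that remain when it is its turn. -/
def serialDictatorship (S : Setting N M) (t : N → Pref M) (π : Fin (Fintype.card N) ≃ N)
    (i : N) (j : M) : ℝ :=
  if IsFavorite (t i) {a | 0 < remainingCap S t π (π.symm i) a} j then 1 else 0

theorem remainingCap_sum (S : Setting N M) (t : N → Pref M) (π : Fin (Fintype.card N) ≃ N)
    (k : ℕ) (hk : k ≤ Fintype.card N) :
    (∑ j, (remainingCap S t π k j : ℝ)) = ∑ j, (S.cap j : ℝ) - k ∧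
    ∀ j, (remainingCap S t π k j : ℝ) + ∑ i, (if ((π.symm i : Fin _) : ℕ) < k then
      serialDictatorship S t π i j else 0) = S.cap j := by
  classical
  induction k with
  | zero => simp [remainingCap]
  | succ k ih =>
    obtain ⟨ih1, ih2⟩ := ih (by omega)
    have hk' : k < Fintype.card N := by omega
    have hne : ({a | 0 < remainingCap S t π k a} : Set M).Nonempty := by
      by_contra h
      rw [Set.not_nonempty_iff_eq_empty] at h
      have h0 : ∀ a, remainingCap S t π k a = 0 := by
        intro a
        by_contra ha
        have : a ∈ ({a | 0 < remainingCap S t π k a} : Set M) := Nat.pos_of_ne_zero ha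
        rw [h] at this
        exact this
      have hs : (Fintype.card N : ℝ) ≤ ∑ j, (S.cap j : ℝ) := by exact_mod_cast S.supply
      have hkr : (k : ℝ) < Fintype.card N := by exact_mod_cast hk'
      simp only [h0, Nat.cast_zero, Finset.sum_const_zero] at ih1
      linarith
    have hstep : ∀ j, (remainingCap S t π (k + 1) j : ℝ) = remainingCap S t π k j -
        (if IsFavorite (t (π ⟨k, hk'⟩)) {a | 0 < remainingCap S t π k a} j then 1 else 0) := by
      intro j
      by_cases hf : IsFavorite (t (π ⟨k, hk'⟩)) {a | 0 < remainingCap S t π k a} j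
      · have hpos : 1 ≤ remainingCap S t π k j := hf.1
        have hex : ∃ h : k < Fintype.card N,
          IsFavorite (t (π ⟨k, h⟩)) {a | 0 < remainingCap S t π k a} j := ⟨hk', hf⟩
        simp only [remainingCap]
        rw [if_pos hex, if_pos hf, Nat.cast_sub hpos, Nat.cast_one]
      · have hex : ¬ ∃ h : k < Fintype.card N,
          IsFavorite (t (π ⟨k, h⟩)) {a | 0 < remainingCap S t π k a} j := fun ⟨_, h⟩ => hf h
        simp only [remainingCap]
        rw [if_neg hex, if_neg hf, sub_zero]
    refine ⟨?_, fun j => ?_⟩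
    · rw [Finset.sum_congr rfl fun j _ => hstep j, Finset.sum_sub_distrib, ih1,
        IsFavorite.sum_ite _ hne]
      push_cast
      ring
    · have hsplit : ∀ i, (if ((π.symm i : Fin _) : ℕ) < k + 1 then
            serialDictatorship S t π i j else 0) =
          (if ((π.symm i : Fin _) : ℕ) < k then serialDictatorship S t π i j else 0) +
          (if i = π ⟨k, hk'⟩ then
            (if IsFavorite (t (π ⟨k, hk'⟩)) {a | 0 < remainingCap S t π k a} j then 1 else 0)
            else 0) := by
        intro i
        by_cases hi : i = π ⟨k, hk'⟩
        · subst hi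
          simp [serialDictatorship]
        · have : ((π.symm i : Fin _) : ℕ) ≠ k := by
            intro h
            apply hi
            rw [← Equiv.symm_apply_eq]
            exact Fin.ext h
          have h2 : ((π.symm i : Fin _) : ℕ) < k + 1 ↔ ((π.symm i : Fin _) : ℕ) < k := by omega
          simp [hi, h2]
      rw [Finset.sum_congr rfl fun i _ => hsplit i, Finset.sum_add_distrib, hstep,
        Finset.sum_ite_eq' Finset.univ, if_pos (Finset.mem_univ _), ← ih2 j]
      ring

theorem serialDictatorship_nonneg (S : Setting N M) (t : N → Pref M)
    (π : Fin (Fintype.card N) ≃ N) (i : N) (j : M) : 0 ≤ serialDictatorship S t π i j := by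
  unfold serialDictatorship
  split_ifs <;> norm_num

theorem serialDictatorship_sum (S : Setting N M) (t : N → Pref M)
    (π : Fin (Fintype.card N) ≃ N) (i : N) : ∑ j, serialDictatorship S t π i j = 1 := by
  classical
  have hk := (π.symm i).isLt
  obtain ⟨h1, -⟩ := remainingCap_sum S t π (π.symm i) hk.le
  apply IsFavorite.sum_ite
  by_contra h
  rw [Set.not_nonempty_iff_eq_empty] at h
  have h0 : ∀ a, remainingCap S t π (π.symm i) a = 0 := by
    intro a
    by_contra ha
    have : a ∈ ({a | 0 < remainingCap S t π (π.symm i) a} : Set M) := Nat.pos_of_ne_zero ha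
    rw [h] at this
    exact this
  have hs : (Fintype.card N : ℝ) ≤ ∑ j, (S.cap j : ℝ) := by exact_mod_cast S.supply
  have hkr : (((π.symm i : Fin _) : ℕ) : ℝ) < Fintype.card N := by exact_mod_cast hk
  simp only [h0, Nat.cast_zero, Finset.sum_const_zero] at h1
  linarith

theorem serialDictatorship_cap (S : Setting N M) (t : N → Pref M)
    (π : Fin (Fintype.card N) ≃ N) (j : M) : ∑ i, serialDictatorship S t π i j ≤ S.cap j := by
  have h := (remainingCap_sum S t π _ le_rfl).2 j
  simp only [Fin.is_lt, if_true] at h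
  have : (0 : ℝ) ≤ remainingCap S t π (Fintype.card N) j := Nat.cast_nonneg _
  linarith

/-- Random Serial Dictatorship: the serial dictatorship with an ordering of the agents that is drawn
uniformly at random from all `n!` orderings. -/
def RSD [DecidableEq N] (S : Setting N M) : Mechanism S := fun t =>
  have hc : ((Fintype.card (Fin (Fintype.card N) ≃ N) : ℕ) : ℝ) = (Fintype.card N).factorial := by
    rw [Fintype.card_equiv (Fintype.equivFin N).symm, Fintype.card_fin]
  have hpos : (0 : ℝ) < (Fintype.card N).factorial := by exact_mod_cast Nat.factorial_pos _
  have hnn : ∀ i j, 0 ≤ (∑ π : Fin (Fintype.card N) ≃ N, serialDictatorship S t π i j) /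
      (Fintype.card N).factorial := fun i j =>
    div_nonneg (Finset.sum_nonneg fun π _ => serialDictatorship_nonneg S t π i j) hpos.le
  have hsum : ∀ i, ∑ j, (∑ π : Fin (Fintype.card N) ≃ N, serialDictatorship S t π i j) /
      (Fintype.card N).factorial = 1 := fun i => by
    rw [← Finset.sum_div, Finset.sum_comm]
    simp only [serialDictatorship_sum, Finset.sum_const, Finset.card_univ, nsmul_eq_mul, mul_one]
    rw [hc, div_self hpos.ne']
  { prob := fun i j => (∑ π : Fin (Fintype.card N) ≃ N, serialDictatorship S t π i j) /
      (Fintype.card N).factorial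
    mem_Icc := fun i j => ⟨hnn i j, by
      rw [← hsum i]
      exact Finset.single_le_sum (f := fun j => (∑ π : Fin (Fintype.card N) ≃ N,
        serialDictatorship S t π i j) / ((Fintype.card N).factorial : ℝ))
        (fun j _ => hnn i j) (Finset.mem_univ j)⟩
    fulfillment := hsum
    capacity := fun j => by
      rw [← Finset.sum_div, Finset.sum_comm, div_le_iff₀ hpos, ← hc]
      calc _ ≤ ∑ _π : Fin (Fintype.card N) ≃ N, (S.cap j : ℝ) :=
            Finset.sum_le_sum fun π _ => serialDictatorship_cap S t π j
        _ = _ := by simp [mul_comm] }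

end RSD

section PS

variable {N M : Type*} [Fintype N] [Fintype M]

/-- A state of the simultaneous eating algorithm: the current time, the amount that is left of each
object, and the share of each object that each agent has eaten so far. -/
structure EatingState (N M : Type*) where
  time : ℝ
  rem : M → ℝ
  share : N → M → ℝ

/-- The objects that are not yet exhausted. -/
def EatingState.available (s : EatingState N M) : Set M := {j | 0 < s.rem j}

open Classical in
/-- The agents that eat from `j`: those whose most preferred available object is `j`. -/
def EatingState.eaters (t : N → Pref M) (s : EatingState N M) (j : M) : Finset N :=
  Finset.univ.filter fun i => IsFavorite (t i) s.available j

open Classical in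
/-- The time until either some object that is being eaten is exhausted, where each agent eats at
unit speed, or the time `1` is reached, whichever happens first. -/
def EatingState.stepLength (t : N → Pref M) (s : EatingState N M) : ℝ :=
  (insert (1 - s.time)
    ((Finset.univ.filter fun j => (s.eaters t j).Nonempty).image
      fun j => s.rem j / (s.eaters t j).card)).min' (Finset.insert_nonempty _ _)

open Classical in
/-- During one step, each agent eats at unit speed from its most preferred available object. -/
def EatingState.step (t : N → Pref M) (s : EatingState N M) : EatingState N M where
  time := s.time + s.stepLength t
  rem j := s.rem j - (s.eaters t j).card * s.stepLength t
  share i j := s.share i j + if IsFavorite (t i) s.available j then s.stepLength t else 0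

/-- At time `0` all objects are completely available. -/
def EatingState.init (S : Setting N M) : EatingState N M where
  time := 0
  rem j := S.cap j
  share _ _ := 0

/-- The state after `k` steps. -/
def eatingState (S : Setting N M) (t : N → Pref M) (k : ℕ) : EatingState N M :=
  (EatingState.step t)^[k] (EatingState.init S)

theorem eatingState_succ (S : Setting N M) (t : N → Pref M) (k : ℕ) :
    eatingState S t (k + 1) = (eatingState S t k).step t :=
  Function.iterate_succ_apply' _ _ _

/-- Bookkeeping facts that hold in every state of the algorithm. -/
structure EatingState.Valid (S : Setting N M) (s : EatingState N M) : Prop where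
  time_le : s.time ≤ 1
  rem_nonneg : ∀ j, 0 ≤ s.rem j
  share_nonneg : ∀ i j, 0 ≤ s.share i j
  rem_add : ∀ j, s.rem j + ∑ i, s.share i j = S.cap j
  sum_share : ∀ i, ∑ j, s.share i j = s.time

theorem EatingState.Valid.time_eq {S : Setting N M} {s : EatingState N M} (hs : s.Valid S) (_ : N)
    (h : ¬ s.available.Nonempty) : s.time = 1 := by
  rw [Set.not_nonempty_iff_eq_empty] at h
  have h0 : ∀ j, s.rem j = 0 := fun j => by
    refine le_antisymm (not_lt.1 fun hj => ?_) (hs.rem_nonneg j)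
    have : j ∈ s.available := hj
    rw [h] at this
    exact this
  have h1 : ∑ j, (S.cap j : ℝ) = Fintype.card N * s.time := by
    simp only [← hs.rem_add, h0, zero_add]
    rw [Finset.sum_comm]
    simp [hs.sum_share]
  have h2 : (Fintype.card N : ℝ) ≤ ∑ j, (S.cap j : ℝ) := by exact_mod_cast S.supply
  have h3 : (0 : ℝ) < Fintype.card N := by
    exact_mod_cast Fintype.card_pos_iff.2 ⟨‹N›⟩
  refine le_antisymm hs.time_le ?_
  rw [h1] at h2
  by_contra h4
  have := mul_lt_mul_of_pos_left (not_le.1 h4) h3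
  linarith

theorem EatingState.stepLength_le (t : N → Pref M) (s : EatingState N M) :
    s.stepLength t ≤ 1 - s.time :=
  Finset.min'_le _ _ (Finset.mem_insert_self _ _)

theorem EatingState.stepLength_mul_le (t : N → Pref M) {S : Setting N M} {s : EatingState N M}
    (hs : s.Valid S) (j : M) : (s.eaters t j).card * s.stepLength t ≤ s.rem j := by
  classical
  by_cases h : (s.eaters t j).Nonempty
  · have hc : (0 : ℝ) < (s.eaters t j).card := by exact_mod_cast h.card_pos
    have h1 : s.stepLength t ≤ s.rem j / (s.eaters t j).card :=
      Finset.min'_le _ _ (Finset.mem_insert_of_mem (Finset.mem_image_of_mem _ (by simpa using h)))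
    rw [le_div_iff₀ hc] at h1
    linarith
  · rw [Finset.not_nonempty_iff_eq_empty] at h
    simpa [h] using hs.rem_nonneg j

theorem EatingState.stepLength_cases (t : N → Pref M) (s : EatingState N M) :
    s.stepLength t = 1 - s.time ∨
      ∃ j, (s.eaters t j).Nonempty ∧ s.stepLength t = s.rem j / (s.eaters t j).card := by
  classical
  have h := Finset.min'_mem _ (Finset.insert_nonempty (1 - s.time)
    ((Finset.univ.filter fun j => (s.eaters t j).Nonempty).image
      fun j => s.rem j / ((s.eaters t j).card : ℝ)))
  rw [Finset.mem_insert, Finset.mem_image] at h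
  rcases h with h | ⟨j, hj, h⟩
  · exact Or.inl h
  · exact Or.inr ⟨j, by simpa using hj, h.symm⟩

theorem EatingState.stepLength_nonneg (t : N → Pref M) {S : Setting N M} {s : EatingState N M}
    (hs : s.Valid S) : 0 ≤ s.stepLength t := by
  rcases s.stepLength_cases t with h | ⟨j, -, h⟩ <;> rw [h]
  · linarith [hs.time_le]
  · exact div_nonneg (hs.rem_nonneg j) (Nat.cast_nonneg _)

theorem EatingState.Valid.step {S : Setting N M} {s : EatingState N M} (hs : s.Valid S)
    (t : N → Pref M) : (s.step t).Valid S where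
  time_le := by
    have := s.stepLength_le t
    simp only [EatingState.step]
    linarith
  rem_nonneg j := sub_nonneg.2 (EatingState.stepLength_mul_le t hs j)
  share_nonneg i j := by
    have := EatingState.stepLength_nonneg t hs
    simp only [EatingState.step]
    have h := hs.share_nonneg i j
    split_ifs <;> linarith
  rem_add j := by
    classical
    simp only [EatingState.step, Finset.sum_add_distrib, ← hs.rem_add j]
    rw [← Finset.sum_filter, Finset.sum_const, nsmul_eq_mul]
    simp only [EatingState.eaters]
    ring
  sum_share i := by
    classical
    simp only [EatingState.step, Finset.sum_add_distrib, hs.sum_share]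
    by_cases h : s.available.Nonempty
    · rw [IsFavorite.sum_ite _ h]
    · have h1 := hs.time_eq i h
      have h2 := EatingState.stepLength_nonneg t hs
      have h3 := s.stepLength_le t
      have h4 : s.stepLength t = 0 := by linarith
      simp [h4]

theorem eatingState_valid (S : Setting N M) (t : N → Pref M) (k : ℕ) :
    (eatingState S t k).Valid S := by
  induction k with
  | zero =>
    exact ⟨zero_le_one, fun j => Nat.cast_nonneg _, fun _ _ => le_rfl,
      fun j => by simp [eatingState, EatingState.init],
      fun i => by simp [eatingState, EatingState.init]⟩
  | succ k ih =>
    rw [eatingState_succ]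
    exact ih.step t

open Classical in
theorem eatingState_progress (S : Setting N M) (t : N → Pref M) (k : ℕ) :
    (eatingState S t k).time = 1 ∨
      k ≤ (Finset.univ.filter fun j => (eatingState S t k).rem j = 0).card := by
  induction k with
  | zero => exact Or.inr (Nat.zero_le _)
  | succ k ih =>
    rw [eatingState_succ]
    have hs := eatingState_valid S t k
    generalize eatingState S t k = s at *
    have h0 := EatingState.stepLength_nonneg t hs
    rcases ih with h | h
    · left
      exact le_antisymm (hs.step t).time_le (by simp only [EatingState.step]; linarith)
    · rcases s.stepLength_cases t with h1 | ⟨j, hj, h1⟩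
      · left
        simp only [EatingState.step]
        linarith
      · right
        refine Nat.succ_le_of_lt (lt_of_le_of_lt h (Finset.card_lt_card ?_))
        obtain ⟨i, hi⟩ := hj
        have hpos : 0 < s.rem j := by
          have := (Finset.mem_filter.1 hi).2.1
          exact this
        have hc : ((s.eaters t j).card : ℝ) ≠ 0 := by
          exact_mod_cast (Finset.card_pos.2 ⟨i, hi⟩).ne'
        rw [Finset.ssubset_iff_of_subset]
        · refine ⟨j, ?_, by simp [hpos.ne']⟩
          rw [Finset.mem_filter]
          refine ⟨Finset.mem_univ j, ?_⟩
          simp only [EatingState.step]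
          rw [h1, mul_div_cancel₀ _ hc, sub_self]
        · intro a ha
          simp only [Finset.mem_filter, Finset.mem_univ, true_and] at ha ⊢
          refine le_antisymm ?_ ((hs.step t).rem_nonneg a)
          have : (0 : ℝ) ≤ (s.eaters t a).card * s.stepLength t :=
            mul_nonneg (Nat.cast_nonneg _) h0
          simp only [EatingState.step]
          linarith

theorem eatingState_time (S : Setting N M) (t : N → Pref M) (i : N) :
    (eatingState S t (Fintype.card M)).time = 1 := by
  classical
  rcases eatingState_progress S t (Fintype.card M) with h | h
  · exact h
  · apply (eatingState_valid S t _).time_eq i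
    rintro ⟨j, hj⟩
    have h1 := Finset.eq_univ_of_card _ (le_antisymm (Finset.card_le_univ _) h)
    have h2 := Finset.mem_univ j
    rw [← h1, Finset.mem_filter] at h2
    exact absurd h2.2 (ne_of_gt hj)

/-- Probabilistic Serial: the shares eaten at time `1` by the simultaneous eating algorithm, in which
all agents eat at unit speed. Every step exhausts an object or reaches time `1`, so that `m` steps,
where `m` is the number of objects, suffice to reach time `1`. -/
def PS (S : Setting N M) : Mechanism S := fun t =>
  have hv := eatingState_valid S t (Fintype.card M)
  have hsum : ∀ i, ∑ j, (eatingState S t (Fintype.card M)).share i j = 1 := fun i => by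
    rw [hv.sum_share, eatingState_time S t i]
  { prob := (eatingState S t (Fintype.card M)).share
    mem_Icc := fun i j => ⟨hv.share_nonneg i j, by
      rw [← hsum i]
      exact Finset.single_le_sum (fun j _ => hv.share_nonneg i j) (Finset.mem_univ j)⟩
    fulfillment := hsum
    capacity := fun j => by
      have h1 := hv.rem_add j
      have h2 := hv.rem_nonneg j
      linarith }

end PS

end

/-!
Under a strategyproof mechanism `f`, a swap of adjacent objects `a ≻ b` in the report of an agent
can only shift probability from `a` to `b`. If anything is shifted at all, the amount is at least
some `δ > 0` that depends on `f` only. By weak invariance of `g` such a swap affects under `g` only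
the objects from `a` downwards, so that it gains the agent at most `u a - min u`, and it gains
nothing where `f` does not react. For `URBI(r)` utilities the loss under `f` is at least
`δ (1 - r) (u a - min u)`, which outweighs the gain once `β` is small. Any other misreport is
reached from the truth by adjacent swaps each of which takes the report further away from it.

For Probabilistic Serial, a swap of `a ≻ b` matters only if, at some time before `1`, both objects
are available and `a` is the favorite of the agent. By Hall's theorem the copies of the objects
exhausted by then can be assigned to other agents that have eaten from them. If these agents pick in
the order in which the objects were exhausted, then the serial dictatorship leaves the agent with
exactly the objects available at that time, so that Random Serial Dictatorship reacts to the swap.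

Since Probabilistic Serial is ordinally efficient, an allocation that ordinally dominates it
coincides with it up to ordinal equivalence, which gives imperfect dominance over every mechanism.
-/

open Finset Function

section AdjacentSwap

variable {M : Type*} [Fintype M] [DecidableEq M] {t t' : Pref M} {a b : M}

namespace Pref.IsAdjacentSwap

theorem lt (h : t.IsAdjacentSwap t' a b) : t a < t b :=
  Fin.lt_def.2 (by have := h.1; omega)

theorem ne (h : t.IsAdjacentSwap t' a b) : a ≠ b :=
  ne_of_apply_ne t h.lt.ne

theorem apply_left (h : t.IsAdjacentSwap t' a b) : t' a = t b := by
  simp [h.2]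

theorem apply_right (h : t.IsAdjacentSwap t' a b) : t' b = t a := by
  simp [h.2]

theorem apply_of_ne (h : t.IsAdjacentSwap t' a b) {c : M} (ha : c ≠ a) (hb : c ≠ b) :
    t' c = t c := by
  simp [h.2, Equiv.swap_apply_of_ne_of_ne ha hb]

theorem symm (h : t.IsAdjacentSwap t' a b) : t'.IsAdjacentSwap t b a :=
  ⟨by rw [h.apply_left, h.apply_right, h.1], Equiv.ext fun c => by simp [h.2, Equiv.swap_comm b a]⟩

theorem lt_iff (h : t.IsAdjacentSwap t' a b) {c d : M} :
    t' c < t' d ↔ c = b ∧ d = a ∨ t c < t d ∧ ¬(c = a ∧ d = b) := by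
  have hne := h.ne
  have hab : (t b : ℕ) = t a + 1 := h.1
  have hinj : ∀ x y : M, (t x : ℕ) = t y → x = y := fun x y hxy => t.injective (Fin.ext hxy)
  have hca := hinj c a
  have hcb := hinj c b
  have hda := hinj d a
  have hdb := hinj d b
  rw [h.2]
  simp only [Equiv.trans_apply, Equiv.swap_apply_def, Fin.lt_def]
  grind

theorem right_lt (h : t.IsAdjacentSwap t' a b) {c : M} (hc : t a ≤ t c) (hb : c ≠ b)
    (ha : c ≠ a) : t b < t c := by
  have hab : (t b : ℕ) = t a + 1 := h.1
  have hne : (t c : ℕ) ≠ t a := fun hac => ha (t.injective (Fin.ext hac))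
  have hne' : (t c : ℕ) ≠ t b := fun hbc => hb (t.injective (Fin.ext hbc))
  rw [Fin.lt_def]
  rw [Fin.le_def] at hc
  omega

theorem isFavorite_of_isFavorite (h : t.IsAdjacentSwap t' a b) {A : Set M}
    (hA : ¬(IsFavorite t A a ∧ b ∈ A)) {j : M} (hj : IsFavorite t A j) : IsFavorite t' A j := by
  refine ⟨hj.1, fun k hk => not_lt.1 fun hlt => ?_⟩
  rcases h.lt_iff.1 hlt with ⟨rfl, rfl⟩ | ⟨hkj, -⟩
  · exact hA ⟨hj, hk⟩
  · exact (hj.2 k hk).not_gt hkj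

theorem isFavorite_iff (h : t.IsAdjacentSwap t' a b) {A : Set M}
    (hA : ¬(IsFavorite t A a ∧ b ∈ A)) (j : M) : IsFavorite t' A j ↔ IsFavorite t A j := by
  refine ⟨fun hj => ?_, h.isFavorite_of_isFavorite hA⟩
  obtain ⟨k, hk⟩ := IsFavorite.exists t ⟨j, hj.1⟩
  rwa [hj.eq (h.isFavorite_of_isFavorite hA hk)]

theorem isFavorite_right (h : t.IsAdjacentSwap t' a b) {A : Set M} (ha : IsFavorite t A a)
    (hb : b ∈ A) : IsFavorite t' A b := by
  refine ⟨hb, fun k hk => ?_⟩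
  rw [h.apply_right]
  by_cases hka : k = a
  · rw [hka, h.apply_left]
    exact h.lt.le
  by_cases hkb : k = b
  · rw [hkb, h.apply_right]
  · rw [h.apply_of_ne hka hkb]
    exact ha.2 k hk

end Pref.IsAdjacentSwap

end AdjacentSwap

section Inversions

variable {M : Type*} [Fintype M]

/-- The inversions of `s` relative to `t`: the pairs that the two preference orderings rank in
opposite directions. Their number measures the distance between `s` and `t`. -/
def Pref.inversions (s t : Pref M) : Finset (M × M) :=
  {p | s p.1 < s p.2 ∧ t p.2 < t p.1}

theorem Pref.exists_inversion {s t : Pref M} (hst : s ≠ t) : ∃ a b, s b < s a ∧ t a < t b := by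
  by_contra! h
  have hmono : StrictMono (s.symm.trans t) := fun x y hxy => by
    have hle := h (s.symm y) (s.symm x) (by simpa using hxy)
    exact lt_of_le_of_ne hle fun he => hxy.ne (s.symm.injective (t.injective he))
  have hid : ⇑(s.symm.trans t) = id := (hmono.range_inj strictMono_id).1 (by simp)
  exact hst (Equiv.ext fun c => by simpa using (congr_fun hid (s c)).symm)

variable [DecidableEq M]

theorem Pref.IsAdjacentSwap.inversions_ssubset {s s' t : Pref M} {a b : M}
    (h : s'.IsAdjacentSwap s a b) (hab : t a < t b) : s'.inversions t ⊂ s.inversions t := by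
  refine (Finset.ssubset_iff_of_subset fun p hp => ?_).2 ⟨(b, a), ?_, ?_⟩
  · simp only [Pref.inversions, mem_filter_univ, h.lt_iff] at hp ⊢
    refine ⟨Or.inr ⟨hp.1, fun hp' => ?_⟩, hp.2⟩
    rw [hp'.1, hp'.2] at hp
    exact hab.not_gt hp.2
  · simp [Pref.inversions, h.apply_left, h.apply_right, h.lt, hab]
  · simp [Pref.inversions, h.lt.le]

/-- Let `a` be the object that `t` ranks highest among those below which `t` ranks an object that
`s` prefers to them, and let `a` pass its predecessor in `s`. -/
theorem Pref.exists_adjacentSwap_toward {s t : Pref M} (hst : s ≠ t) :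
    ∃ (s' : Pref M) (a b : M), s'.IsAdjacentSwap s a b ∧ t a < t b ∧
      ∀ j, s' a < s' j → t a < t j := by
  obtain ⟨x, y, hxy⟩ := Pref.exists_inversion hst
  obtain ⟨a, ⟨c, hca, hac⟩, hmin⟩ :=
    Set.exists_min_image {a | ∃ c, s c < s a ∧ t a < t c} t (Set.toFinite _) ⟨x, y, hxy⟩
  obtain ⟨b, hb⟩ : ∃ b, (s a : ℕ) = s b + 1 :=
    ⟨s.symm ⟨s a - 1, by omega⟩, by rw [Equiv.apply_symm_apply]; simp only; omega⟩
  have hswap : Pref.IsAdjacentSwap s ((Equiv.swap b a).trans s) b a := ⟨hb, rfl⟩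
  have hab : t a < t b := by
    refine lt_of_le_of_ne (not_lt.1 fun hba => ?_) (t.injective.ne hswap.ne.symm)
    have hcb : s c ≠ s b := s.injective.ne fun hcb => (hcb ▸ hac).not_gt hba
    have hcb' : s c < s b := by
      rw [Fin.lt_def]
      rw [Fin.lt_def] at hca
      have := Fin.val_ne_of_ne hcb
      omega
    exact (hmin b ⟨c, hcb', hba.trans hac⟩).not_gt hba
  refine ⟨_, a, b, hswap.symm, hab, fun j hj => ?_⟩
  rcases hswap.lt_iff.1 hj with ⟨-, rfl⟩ | ⟨hlt, -⟩
  · exact hab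
  · exact lt_of_le_of_ne (not_lt.1 fun hja => (hmin j ⟨a, hlt, hja⟩).not_gt hja)
      (t.injective.ne fun haj => (haj ▸ hlt).false)

theorem Pref.le_of_adjacentSwap_toward {α : Type*} [Preorder α] {t : Pref M} {V : Pref M → α}
    (hV : ∀ s s' a b, s.IsAdjacentSwap s' a b → t a < t b → (∀ j, s a < s j → t a < t j) →
      V s' ≤ V s) (s : Pref M) : V s ≤ V t := by
  induction hs : s.inversions t using Finset.strongInduction generalizing s with
  | H I ih =>
    by_cases hst : s = t
    · rw [hst]
    · obtain ⟨s', a, b, hswap, hab, hbelow⟩ := Pref.exists_adjacentSwap_toward hst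
      exact (hV s' s a b hswap hab hbelow).trans
        (ih _ (hs ▸ hswap.inversions_ssubset hab) s' rfl)

end Inversions

section UpperWeight

variable {M : Type*} [Fintype M] {t t' : Pref M} {v w : M → ℝ} {a b c : M}

theorem upperWeight_eq_sum_ite (t : Pref M) (v : M → ℝ) (b : M) :
    upperWeight t v b = ∑ j, if t j < t b then v j else 0 := by
  rw [upperWeight, ← sum_filter]
  congr!

theorem upperWeight_add_self (t : Pref M) (v : M → ℝ) (b : M) :
    upperWeight t v b + v b = ∑ j, if t j ≤ t b then v j else 0 := by
  classical
  have hself : v b = ∑ j, if j = b then v j else 0 := by simp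
  rw [upperWeight_eq_sum_ite, hself, ← sum_add_distrib]
  refine sum_congr rfl fun j _ => ?_
  rcases lt_trichotomy (t j) (t b) with h | h | h
  · simp [h, h.le, ne_of_apply_ne t h.ne]
  · simp [t.injective h]
  · simp [h.not_gt, h.not_ge, ne_of_apply_ne t h.ne']

theorem FOSD.upperWeight_add_self_le (h : FOSD t v w) (hsum : ∑ j, v j = ∑ j, w j) (b : M) :
    upperWeight t w b + w b ≤ upperWeight t v b + v b := by
  simp only [upperWeight_add_self]
  by_cases hb : (t b : ℕ) + 1 < Fintype.card M
  · have hiff : ∀ j, t j ≤ t b ↔ t j < t (t.symm ⟨t b + 1, hb⟩) := fun j => by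
      rw [Equiv.apply_symm_apply, Fin.lt_def, Fin.le_def, Nat.lt_succ_iff]
    simpa only [hiff, ← upperWeight_eq_sum_ite] using h (t.symm ⟨t b + 1, hb⟩)
  · have hle : ∀ j, t j ≤ t b := fun j => by
      have := (t j).isLt
      rw [Fin.le_def]
      omega
    simp only [hle, if_true, hsum, le_refl]

theorem FOSD.apply_le (h : FOSD t v w) (hsum : ∑ j, v j = ∑ j, w j)
    (hb : upperWeight t v b = upperWeight t w b) : w b ≤ v b := by
  have := h.upperWeight_add_self_le hsum b
  linarith

/-- Test against the utilities that add a large bonus on the objects above `b` to the negative of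
the rank. -/
theorem fosd_of_forall_consistent
    (h : ∀ u, t.Consistent u → 0 ≤ ∑ j, u j * (v j - w j)) : FOSD t v w := by
  intro b
  by_contra! hlt
  obtain ⟨K, hK⟩ := exists_nat_gt
    ((∑ j, (t j : ℝ) * (w j - v j)) / (upperWeight t w b - upperWeight t v b))
  rw [div_lt_iff₀ (sub_pos.2 hlt)] at hK
  have hcons : t.Consistent fun j => (K : ℝ) * (if t j < t b then 1 else 0) - (t j : ℕ) := by
    have hanti : StrictAnti fun x : Fin (Fintype.card M) =>
        (K : ℝ) * (if x < t b then 1 else 0) - (x : ℕ) := fun x y hxy => by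
      have hcast : ((x : ℕ) : ℝ) < (y : ℕ) := by exact_mod_cast hxy
      have hbonus : (if y < t b then (1 : ℝ) else 0) ≤ if x < t b then 1 else 0 := by
        by_cases hy : y < t b
        · simp [hy, hxy.trans hy]
        · rw [if_neg hy]
          split_ifs <;> norm_num
      have := mul_le_mul_of_nonneg_left hbonus (Nat.cast_nonneg (α := ℝ) K)
      dsimp only
      linarith
    exact fun j k => hanti.lt_iff_gt.symm
  have h0 := h _ hcons
  have hsplit : ∑ j, ((K : ℝ) * (if t j < t b then 1 else 0) - (t j : ℕ)) * (v j - w j) =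
      K * (upperWeight t v b - upperWeight t w b) + ∑ j, (t j : ℝ) * (w j - v j) := by
    rw [upperWeight_eq_sum_ite, upperWeight_eq_sum_ite, ← sum_sub_distrib, mul_sum,
      ← sum_add_distrib]
    refine sum_congr rfl fun j _ => ?_
    split_ifs <;> ring
  linarith

variable [DecidableEq M]

theorem Pref.IsAdjacentSwap.upperWeight_of_ne (h : t.IsAdjacentSwap t' a b) (v : M → ℝ)
    (ha : c ≠ a) (hb : c ≠ b) : upperWeight t' v c = upperWeight t v c := by
  simp only [upperWeight_eq_sum_ite, h.lt_iff, ha, hb, and_false, false_or, not_false_eq_true,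
    and_true]

theorem Pref.IsAdjacentSwap.upperWeight_right (h : t.IsAdjacentSwap t' a b) (v : M → ℝ) :
    upperWeight t' v b = upperWeight t v a := by
  have hiff : ∀ j, t' j < t' b ↔ t j < t a := fun j => by
    rw [h.lt_iff]
    refine ⟨?_, fun hj => ?_⟩
    · rintro (⟨-, hba⟩ | ⟨hjb, hja⟩)
      · exact absurd hba.symm h.ne
      · by_contra! hle
        rcases eq_or_ne j b with rfl | hne
        · exact hjb.false
        · exact (h.right_lt hle hne fun hja' => hja ⟨hja', rfl⟩).not_gt hjb
    · exact Or.inr ⟨hj.trans h.lt, fun hja => (hja.1 ▸ hj).false⟩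
  simp only [upperWeight_eq_sum_ite, hiff]

theorem FOSD.le_of_isAdjacentSwap (h : FOSD t v w) (h' : FOSD t' w v)
    (hsum : ∑ j, v j = ∑ j, w j) (hswap : t.IsAdjacentSwap t' a b) : w a ≤ v a :=
  h.apply_le hsum <| le_antisymm
    (by simpa only [hswap.upperWeight_right] using h' b) (h a)

theorem FOSD.eq_of_isAdjacentSwap (h : FOSD t v w) (h' : FOSD t' w v)
    (hsum : ∑ j, v j = ∑ j, w j) (hswap : t.IsAdjacentSwap t' a b) (ha : c ≠ a) (hb : c ≠ b) :
    v c = w c := by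
  have heq : upperWeight t v c = upperWeight t w c :=
    le_antisymm (by simpa only [hswap.upperWeight_of_ne _ ha hb] using h' c) (h c)
  refine le_antisymm (h'.apply_le hsum.symm ?_) (h.apply_le hsum heq)
  simp only [hswap.upperWeight_of_ne _ ha hb, heq]

theorem FOSD.sum_mul_sub_of_isAdjacentSwap (h : FOSD t v w) (h' : FOSD t' w v)
    (hsum : ∑ j, v j = ∑ j, w j) (hswap : t.IsAdjacentSwap t' a b) (u : M → ℝ) :
    ∑ j, u j * (v j - w j) = (v a - w a) * (u a - u b) := by
  have hzero : ∀ j, j ≠ a ∧ j ≠ b → v j - w j = 0 := fun j hj =>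
    sub_eq_zero.2 (h.eq_of_isAdjacentSwap h' hsum hswap hj.1 hj.2)
  have htotal : v a - w a + (v b - w b) = 0 := by
    rw [← Fintype.sum_eq_add a b hswap.ne hzero, sum_sub_distrib, hsum, sub_self]
  rw [Fintype.sum_eq_add a b hswap.ne fun j hj => by rw [hzero j hj, mul_zero]]
  linear_combination u b * htotal

end UpperWeight

section HybridIncentives

variable {N M : Type*} [Fintype N] [Fintype M] {S : Setting N M} {f g : Mechanism S} {i : N}
  {t : N → Pref M} {t' : Pref M} {a b : M}

theorem Mechanism.exists_pos_le_prob_sub (f : Mechanism S) :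
    ∃ δ > 0, ∀ t t' i j, (f t').prob i j < (f t).prob i j →
      δ ≤ (f t).prob i j - (f t').prob i j := by
  obtain ⟨δ, hδ⟩ := Finite.exists_ge
    fun p : {p : ((N → Pref M) × (N → Pref M)) × N × M //
        (f p.1.2).prob p.2.1 p.2.2 < (f p.1.1).prob p.2.1 p.2.2} =>
      (⟨_, sub_pos.2 p.2⟩ : Set.Ioi (0 : ℝ))
  exact ⟨δ, δ.2, fun t t' i j h => hδ ⟨((t, t'), i, j), h⟩⟩

theorem Allocation.sum_sub_const_mul_sub (x y : Allocation S) (i : N) (u : M → ℝ) (c : ℝ) :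
    ∑ j, (u j - c) * (x.prob i j - y.prob i j) = ∑ j, u j * (x.prob i j - y.prob i j) := by
  simp only [sub_mul, sum_sub_distrib, ← mul_sum, x.fulfillment, y.fulfillment, sub_self, mul_zero,
    sub_zero]

variable [DecidableEq N]

theorem Mechanism.Strategyproof.fosd (hf : f.Strategyproof) (t : N → Pref M) (i : N)
    (t' : Pref M) : FOSD (t i) ((f t).prob i) ((f (update t i t')).prob i) :=
  fosd_of_forall_consistent (hf i t t')

variable [DecidableEq M]

theorem Mechanism.Strategyproof.prob_le_of_isAdjacentSwap (hf : f.Strategyproof)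
    (h : (t i).IsAdjacentSwap t' a b) :
    (f (update t i t')).prob i a ≤ (f t).prob i a := by
  have h' := hf.fosd (update t i t') i (t i)
  simp only [update_self, update_idem, update_eq_self] at h'
  exact (hf.fosd t i t').le_of_isAdjacentSwap h'
    (((f t).fulfillment i).trans ((f _).fulfillment i).symm) h

theorem Mechanism.Strategyproof.sum_mul_sub_of_isAdjacentSwap (hf : f.Strategyproof)
    (h : (t i).IsAdjacentSwap t' a b) (u : M → ℝ) :
    ∑ j, u j * ((f t).prob i j - (f (update t i t')).prob i j) =
      ((f t).prob i a - (f (update t i t')).prob i a) * (u a - u b) := by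
  have h' := hf.fosd (update t i t') i (t i)
  simp only [update_self, update_idem, update_eq_self] at h'
  exact (hf.fosd t i t').sum_mul_sub_of_isAdjacentSwap h'
    (((f t).fulfillment i).trans ((f _).fulfillment i).symm) h u

theorem Mechanism.Strategyproof.prob_eq_of_isAdjacentSwap (hf : f.Strategyproof)
    (h : (t i).IsAdjacentSwap t' a b) (ha : (f t).prob i a = (f (update t i t')).prob i a) :
    (f t).prob i = (f (update t i t')).prob i := by
  funext k
  have := hf.sum_mul_sub_of_isAdjacentSwap h (Pi.single k 1)
  simpa [Pi.single_apply, ha, sub_eq_zero] using this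

/-- The probabilities above `a` are unchanged, and in the worst case the agent loses the full value
of `a`. -/
theorem Mechanism.WeaklyInvariant.neg_le_sum_mul_sub (hg : g.WeaklyInvariant)
    (h : (t i).IsAdjacentSwap t' a b) {w : M → ℝ} (hw : ∀ j, 0 ≤ w j)
    (hwa : ∀ j, t i a ≤ t i j → w j ≤ w a) :
    -w a ≤ ∑ j, w j * ((g t).prob i j - (g (update t i t')).prob i j) := by
  calc -w a = ∑ j, -w a * (g (update t i t')).prob i j := by
        rw [← mul_sum, (g _).fulfillment, mul_one]
    _ ≤ _ := sum_le_sum fun j _ => ?_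
  have hy := ((g t).mem_Icc i j).1
  have hy' := ((g (update t i t')).mem_Icc i j).1
  rcases lt_or_ge (t i j) (t i a) with hj | hj
  · rw [hg i t t' a b h j hj, sub_self, mul_zero, neg_mul]
    exact neg_nonpos.2 (mul_nonneg (hw a) hy')
  · nlinarith [mul_nonneg (hw j) hy, mul_nonneg (sub_nonneg.2 (hwa j hj)) hy']

/-- Either the report of `t'` has no effect on `g`, or it has an effect on `f` of size at least `δ`.
In the second case the loss under `f` outweighs the gain under `g`, which is at most the value of
`a`. -/
theorem HybridAdmissible.sum_mul_le_of_isAdjacentSwap (h : HybridAdmissible f g) {β r δ : ℝ}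
    (hβ : β ∈ Set.Icc (0 : ℝ) 1) (hβδ : β ≤ (1 - β) * (δ * (1 - r))) (hr : r < 1)
    (hδ : ∀ t t' i j, (f t').prob i j < (f t).prob i j → δ ≤ (f t).prob i j - (f t').prob i j)
    (hswap : (t i).IsAdjacentSwap t' a b) {u : M → ℝ} (hu : URBI r u) (hab : u b < u a)
    (hua : ∀ j, t i a < t i j → u j < u a) :
    ∑ j, u j * (hybrid β hβ f g (update t i t')).prob i j ≤
      ∑ j, u j * (hybrid β hβ f g t).prob i j := by
  set w : M → ℝ := fun j => u j - ⨅ c, u c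
  have hw : ∀ j, 0 ≤ w j := fun j => sub_nonneg.2 (ciInf_le (Set.finite_range u).bddBelow j)
  have hwa : ∀ j, t i a ≤ t i j → w j ≤ w a := fun j hj => by
    rcases hj.eq_or_lt with hj | hj
    · rw [(t i).injective hj]
    · exact sub_le_sub_right (hua j hj).le _
  set d := (f t).prob i a - (f (update t i t')).prob i a with hd
  set G := ∑ j, u j * ((g t).prob i j - (g (update t i t')).prob i j) with hG
  have hsplit : ∑ j, u j * (hybrid β hβ f g t).prob i j -
      ∑ j, u j * (hybrid β hβ f g (update t i t')).prob i j =
        (1 - β) * (d * (u a - u b)) + β * G := by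
    rw [hd, hG, ← h.strategyproof.sum_mul_sub_of_isAdjacentSwap hswap u, mul_sum, mul_sum,
      ← sum_sub_distrib, ← sum_add_distrib]
    exact sum_congr rfl fun j _ => by simp only [hybrid, Allocation.mix]; ring
  rw [← sub_nonneg, hsplit]
  rcases (h.strategyproof.prob_le_of_isAdjacentSwap hswap).eq_or_lt with heq | hlt
  · have hg0 : (g t).prob i = (g (update t i t')).prob i := by
      by_contra hne
      exact h.weaklyLessVarying i t t' ⟨a, b, hswap⟩ hne
        (h.strategyproof.prob_eq_of_isAdjacentSwap hswap heq.symm)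
    simp [hd, hG, heq, hg0]
  · have hGw : -w a ≤ G := by
      rw [hG, ← Allocation.sum_sub_const_mul_sub _ _ _ _ (⨅ c, u c)]
      exact h.weaklyInvariant.neg_le_sum_mul_sub hswap hw hwa
    have hdδ : δ * ((1 - r) * w a) ≤ d * (u a - u b) :=
      mul_le_mul (hδ _ _ i a hlt) (by linarith [hu a b hab])
        (mul_nonneg (sub_nonneg.2 hr.le) (hw a)) (sub_pos.2 hlt).le
    have hmain := mul_le_mul_of_nonneg_right hβδ (hw a)
    have hf := mul_le_mul_of_nonneg_left hdδ (sub_nonneg.2 hβ.2)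
    have hg := mul_le_mul_of_nonneg_left hGw hβ.1
    linarith

theorem HybridAdmissible.exists_partiallyStrategyproof_hybrid (h : HybridAdmissible f g) {r : ℝ}
    (hr : r < 1) : ∃ (β : ℝ) (hβ : β ∈ Set.Ioo (0 : ℝ) 1),
      (hybrid β (Set.Ioo_subset_Icc_self hβ) f g).PartiallyStrategyproof r := by
  obtain ⟨δ, hδ, hδf⟩ := f.exists_pos_le_prob_sub
  set c := δ * (1 - r)
  have hcpos : 0 < c := mul_pos hδ (sub_pos.2 hr)
  have hβ : c / (1 + c) ∈ Set.Ioo (0 : ℝ) 1 :=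
    ⟨by positivity, (div_lt_one (by positivity)).2 (by linarith)⟩
  have hβc : c / (1 + c) ≤ (1 - c / (1 + c)) * c := by
    apply le_of_eq
    field_simp
    ring
  refine ⟨_, hβ, fun i t t' u hcons hu => ?_⟩
  set H := hybrid _ (Set.Ioo_subset_Icc_self hβ) f g
  have hstep : ∀ (s s' : Pref M) (a b : M), s.IsAdjacentSwap s' a b → t i a < t i b →
      (∀ j, s a < s j → t i a < t i j) →
      ∑ j, u j * (H (update t i s')).prob i j ≤ ∑ j, u j * (H (update t i s)).prob i j := by
    intro s s' a b hswap hab hbelow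
    have := h.sum_mul_le_of_isAdjacentSwap (i := i) (t := update t i s) (t' := s') (a := a) (b := b)
      (Set.Ioo_subset_Icc_self hβ) hβc hr hδf (by simpa using hswap) hu ((hcons a b).1 hab)
      (fun j hj => (hcons a j).1 (hbelow j (by simpa using hj)))
    simpa only [update_idem] using this
  have htruth := Pref.le_of_adjacentSwap_toward hstep t'
  simp only [update_eq_self] at htruth
  simpa only [mul_sub, sum_sub_distrib, sub_nonneg] using htruth

end HybridIncentives

section HybridEfficiency

variable {N M : Type*} [Fintype N] [Fintype M] {S : Setting N M} {f g : Mechanism S} {β : ℝ}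
  {t : N → Pref M}

theorem upperWeight_hybrid_sub (hβ : β ∈ Set.Icc (0 : ℝ) 1) (f g : Mechanism S) (t : N → Pref M)
    (i : N) (b : M) :
    upperWeight (t i) ((hybrid β hβ f g t).prob i) b - upperWeight (t i) ((f t).prob i) b =
      β * (upperWeight (t i) ((g t).prob i) b - upperWeight (t i) ((f t).prob i) b) := by
  simp only [upperWeight, ← sum_sub_distrib, mul_sum]
  exact sum_congr rfl fun j _ => by simp only [hybrid, Allocation.mix]; ring

theorem upperWeight_lt_hybrid_iff (hβ : β ∈ Set.Icc (0 : ℝ) 1) (hβ0 : 0 < β) {i : N} {b : M} :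
    upperWeight (t i) ((f t).prob i) b < upperWeight (t i) ((hybrid β hβ f g t).prob i) b ↔
      upperWeight (t i) ((f t).prob i) b < upperWeight (t i) ((g t).prob i) b := by
  rw [← sub_pos, upperWeight_hybrid_sub, mul_pos_iff_of_pos_left hβ0, sub_pos]

theorem ordDominates_hybrid_iff (hβ : β ∈ Set.Icc (0 : ℝ) 1) (hβ0 : 0 < β) :
    OrdDominates t (hybrid β hβ f g t) (f t) ↔ OrdDominates t (g t) (f t) :=
  forall₂_congr fun i b => by
    rw [← sub_nonneg, upperWeight_hybrid_sub, mul_nonneg_iff_of_pos_left hβ0, sub_nonneg]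

theorem hybrid_ordDominated_iff (hβ : β ∈ Set.Icc (0 : ℝ) 1) (hβ0 : 0 < β) :
    OrdDominates t (f t) (hybrid β hβ f g t) ↔ OrdDominates t (f t) (g t) :=
  forall₂_congr fun i b => by rw [← not_lt, upperWeight_lt_hybrid_iff hβ hβ0, not_lt]

theorem ImperfectOrdDominates.hybrid (h : ImperfectOrdDominates g f)
    (hβ : β ∈ Set.Icc (0 : ℝ) 1) (hβ0 : 0 < β) :
    ImperfectOrdDominates (hybrid β hβ f g) f := fun t => by
  rw [ordDominates_hybrid_iff hβ hβ0, hybrid_ordDominated_iff hβ hβ0]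
  exact h t

theorem StrictImperfectOrdDominates.hybrid (h : StrictImperfectOrdDominates g f)
    (hβ : β ∈ Set.Icc (0 : ℝ) 1) (hβ0 : 0 < β) :
    StrictImperfectOrdDominates (_root_.hybrid β hβ f g) f :=
  ⟨h.1.hybrid hβ hβ0, h.2.imp fun _ ⟨hdom, i, b, hlt⟩ =>
    ⟨(ordDominates_hybrid_iff hβ hβ0).2 hdom, i, b, (upperWeight_lt_hybrid_iff hβ hβ0).2 hlt⟩⟩

end HybridEfficiency

section SerialDictatorship

variable {N M : Type*} [Fintype N] [Fintype M] {S : Setting N M} {t : N → Pref M}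
  {π : Fin (Fintype.card N) ≃ N} {i : N} {j : M}

open Classical in
theorem IsFavorite.sum_mul_ite {t : Pref M} {A : Set M} {c : M} (hc : IsFavorite t A c)
    (u : M → ℝ) : ∑ j, u j * (if IsFavorite t A j then 1 else 0) = u c := by
  have hiff : ∀ j, IsFavorite t A j ↔ j = c := fun j => ⟨fun hj => hj.eq hc, fun hj => hj ▸ hc⟩
  simp [hiff]

theorem Pref.Consistent.le_of_isFavorite {t : Pref M} {u : M → ℝ} (hu : t.Consistent u)
    {A : Set M} {c d : M} (hc : IsFavorite t A c) (hd : d ∈ A) : u d ≤ u c :=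
  not_lt.1 fun h => (hc.2 d hd).not_gt ((hu d c).2 h)

/-- The objects among which agent `i` picks in the serial dictatorship with ordering `π`. -/
def remainingObjects (S : Setting N M) (t : N → Pref M) (π : Fin (Fintype.card N) ≃ N) (i : N) :
    Set M :=
  {j | 0 < remainingCap S t π (π.symm i) j}

theorem remainingObjects_nonempty (S : Setting N M) (t : N → Pref M)
    (π : Fin (Fintype.card N) ≃ N) (i : N) : (remainingObjects S t π i).Nonempty := by
  by_contra h
  have hno : ∀ j, ¬IsFavorite (t i) (remainingObjects S t π i) j := fun j hj => h ⟨j, hj.1⟩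
  have hsum := serialDictatorship_sum S t π i
  simp only [remainingObjects] at hno
  simp [serialDictatorship, hno] at hsum

open Classical in
theorem remainingCap_add_card {k : ℕ} (hk : k ≤ Fintype.card N) {σ : N → M}
    (hσ : ∀ v, π.symm v < k → IsFavorite (t v) (remainingObjects S t π v) (σ v)) (j : M) :
    remainingCap S t π k j + #{v | (π.symm v : ℕ) < k ∧ σ v = j} = S.cap j := by
  rw [← Nat.cast_inj (R := ℝ), ← (remainingCap_sum S t π k hk).2 j, Nat.cast_add, card_filter,
    Nat.cast_sum]
  refine congrArg _ (sum_congr rfl fun v _ => ?_)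
  by_cases hv : (π.symm v : ℕ) < k
  · have hiff : IsFavorite (t v) {a | 0 < remainingCap S t π (π.symm v) a} j ↔ σ v = j :=
      ⟨(hσ v hv).eq, fun h => h ▸ hσ v hv⟩
    simp [serialDictatorship, hv, hiff]
  · simp [hv]

theorem exists_ordering_of_priority {α : Type*} [LinearOrder α] (p : N → α) :
    ∃ π : Fin (Fintype.card N) ≃ N, ∀ v w, p v < p w → π.symm v < π.symm w := by
  let E := Fintype.equivFin N
  refine ⟨(Tuple.sort (p ∘ E.symm)).trans E.symm, fun v w hvw => ?_⟩
  simpa using (Tuple.monotone_sort (p ∘ E.symm)).reflect_lt (by simpa using hvw)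

section Priority

variable {α : Type*} [LinearOrder α] [OrderTop α] {σ : N → M} {e : M → α}

open Classical in
theorem isFavorite_remainingObjects_of_priority (hcap : ∀ j, e j ≠ ⊤ → #{v | σ v = j} = S.cap j)
    (hpref : ∀ v, e (σ v) ≠ ⊤ → ∀ j, t v j < t v (σ v) → e j < e (σ v))
    (hπ : ∀ v w, e (σ v) < e (σ w) → π.symm v < π.symm w) {v : N} (hv : e (σ v) ≠ ⊤) :
    IsFavorite (t v) (remainingObjects S t π v) (σ v) := by
  induction hk : π.symm v using WellFoundedLT.induction generalizing v with
  | ind k ih =>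
    subst hk
    have hcount := remainingCap_add_card (t := t) (σ := σ) (π.symm v).isLt.le fun w hw =>
      ih _ hw (fun hw' => (hπ v w (hw' ▸ hv.lt_top)).not_gt hw) rfl
    refine ⟨?_, fun j hj => not_lt.1 fun hlt => ?_⟩
    · have hfree : #{w | (π.symm w : ℕ) < π.symm v ∧ σ w = σ v} < #{w | σ w = σ v} :=
        card_lt_card <| (ssubset_iff_of_subset fun w hw => by simp_all).2 ⟨v, by simp, by simp⟩
      have := hcount (σ v)
      rw [hcap _ hv] at hfree
      simp only [remainingObjects, Set.mem_ofPred_eq]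
      omega
    · have hej := hpref v hv j hlt
      have hall : #{w | (π.symm w : ℕ) < π.symm v ∧ σ w = j} = #{w | σ w = j} :=
        congrArg card (filter_congr fun w _ => and_iff_right_of_imp fun hw => hπ w v (hw ▸ hej))
      have := hcount j
      rw [hall, hcap j hej.ne_top] at this
      simp only [remainingObjects, Set.mem_ofPred_eq] at hj
      omega

open Classical in
/-- Let the agents that `σ` sends to an object of finite priority pick in the order of these
priorities, followed by `i` and then by all other agents. -/
theorem exists_ordering_remainingObjects_eq (hcap : ∀ j, e j ≠ ⊤ → #{v | σ v = j} = S.cap j)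
    (hpref : ∀ v, e (σ v) ≠ ⊤ → ∀ j, t v j < t v (σ v) → e j < e (σ v)) (hi : e (σ i) = ⊤) :
    ∃ π : Fin (Fintype.card N) ≃ N, remainingObjects S t π i = {j | e j = ⊤ ∧ 0 < S.cap j} := by
  obtain ⟨π, hπ⟩ := exists_ordering_of_priority fun v => toLex (e (σ v), decide (v ≠ i))
  simp only [Prod.Lex.toLex_lt_toLex] at hπ
  have hπe : ∀ v w, e (σ v) < e (σ w) → π.symm v < π.symm w := fun v w h => hπ v w (Or.inl h)
  have hbefore : ∀ v, π.symm v < π.symm i ↔ e (σ v) ≠ ⊤ := fun v =>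
    ⟨fun hv htop => (hπ i v (Or.inr ⟨hi.trans htop.symm, by
      simp [ne_of_apply_ne π.symm hv.ne]⟩)).not_gt hv, fun hv => hπe v i (hi ▸ hv.lt_top)⟩
  have hcount := remainingCap_add_card (t := t) (σ := σ) (π.symm i).isLt.le fun v hv =>
    isFavorite_remainingObjects_of_priority hcap hpref hπe ((hbefore v).1 hv)
  refine ⟨π, Set.ext fun j => ?_⟩
  simp only [Fin.val_fin_lt, hbefore] at hcount
  rw [remainingObjects, Set.mem_ofPred_eq, Set.mem_ofPred_eq, ← hcount j]
  by_cases hj : e j = ⊤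
  · have hnone : #{v | e (σ v) ≠ ⊤ ∧ σ v = j} = 0 :=
      card_eq_zero.2 (filter_false_of_mem fun v _ hv => hv.1 (hv.2 ▸ hj))
    simp [hnone, hj]
  · have hall : #{v | e (σ v) ≠ ⊤ ∧ σ v = j} = #{v | σ v = j} :=
      congrArg card (filter_congr fun v _ => and_iff_right_of_imp fun hv => hv ▸ hj)
    have := hcount j
    rw [hall, hcap j hj] at this
    simp only [hj, false_and, iff_false]
    omega

end Priority

variable [DecidableEq N] {t' : Pref M}

theorem remainingCap_update (S : Setting N M) (t : N → Pref M) (π : Fin (Fintype.card N) ≃ N)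
    (i : N) (t' : Pref M) {k : ℕ} (hk : k ≤ π.symm i) :
    remainingCap S (update t i t') π k = remainingCap S t π k := by
  classical
  induction k with
  | zero => rfl
  | succ k ih =>
    have hne : ∀ h : k < Fintype.card N, π ⟨k, h⟩ ≠ i := by
      rintro h rfl
      simp at hk
    funext j
    simp only [remainingCap, ih (by omega)]
    exact if_congr (exists_congr fun h => by rw [update_of_ne (hne h)]) rfl rfl

open Classical in
theorem serialDictatorship_update (S : Setting N M) (t : N → Pref M)
    (π : Fin (Fintype.card N) ≃ N) (i : N) (t' : Pref M) (j : M) :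
    serialDictatorship S (update t i t') π i j =
      if IsFavorite t' (remainingObjects S t π i) j then 1 else 0 := by
  rw [serialDictatorship, remainingCap_update S t π i t' le_rfl, update_self, remainingObjects]

theorem RSD_strategyproof (S : Setting N M) : (RSD S).Strategyproof := by
  classical
  intro i t t' u hu
  have hpick : ∀ π, 0 ≤ ∑ j, u j * (serialDictatorship S t π i j -
      serialDictatorship S (update t i t') π i j) := fun π => by
    obtain ⟨c, hc⟩ := IsFavorite.exists (t i) (remainingObjects_nonempty S t π i)
    obtain ⟨d, hd⟩ := IsFavorite.exists t' (remainingObjects_nonempty S t π i)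
    have ht := serialDictatorship_update S t π i (t i)
    rw [update_eq_self] at ht
    simp only [ht, serialDictatorship_update, mul_sub, sum_sub_distrib, hc.sum_mul_ite,
      hd.sum_mul_ite]
    exact sub_nonneg.2 (hu.le_of_isFavorite hc hd.1)
  have havg : ∑ j, u j * ((RSD S t).prob i j - (RSD S (update t i t')).prob i j) =
      (∑ π, ∑ j, u j * (serialDictatorship S t π i j -
        serialDictatorship S (update t i t') π i j)) / (Fintype.card N).factorial := by
    rw [sum_comm, sum_div]
    refine sum_congr rfl fun j _ => ?_
    simp only [RSD, ← mul_sum, sum_sub_distrib]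
    ring
  rw [havg]
  exact div_nonneg (sum_nonneg fun π _ => hpick π) (Nat.cast_nonneg _)

variable [DecidableEq M]

theorem RSD_prob_lt_of_isAdjacentSwap {a b : M} (h : (t i).IsAdjacentSwap t' a b)
    (ha : IsFavorite (t i) (remainingObjects S t π i) a) (hb : b ∈ remainingObjects S t π i) :
    (RSD S (update t i t')).prob i a < (RSD S t).prob i a := by
  classical
  have ht : ∀ ρ, serialDictatorship S t ρ i a =
      if IsFavorite (t i) (remainingObjects S t ρ i) a then 1 else 0 := fun _ => rfl
  refine div_lt_div_of_pos_right
    (sum_lt_sum (fun ρ _ => ?_) ⟨π, mem_univ π, ?_⟩) (by positivity)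
  · rw [serialDictatorship_update, ht]
    by_cases hρ : IsFavorite (t i) (remainingObjects S t ρ i) a
    · rw [if_pos hρ]
      split_ifs <;> norm_num
    · rw [h.isFavorite_iff fun hc => hρ hc.1]
  · rw [serialDictatorship_update, ht, if_pos ha,
      if_neg fun ha' => h.ne (ha'.eq (h.isFavorite_right ha hb))]
    exact zero_lt_one

end SerialDictatorship

section Eating

variable {N M : Type*} [Fintype N] [Fintype M] {S : Setting N M} {t : N → Pref M} {k l : ℕ}
  {v i : N} {j : M}

theorem IsFavorite.notMem_of_lt {p : Pref M} {A : Set M} {c : M} (hc : IsFavorite p A c)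
    (h : p j < p c) : j ∉ A := fun hj => (hc.2 j hj).not_gt h

theorem EatingState.step_congr {t' : N → Pref M} {s : EatingState N M}
    (h : ∀ v j, IsFavorite (t v) s.available j ↔ IsFavorite (t' v) s.available j) :
    s.step t = s.step t' := by
  classical
  have heaters : s.eaters t = s.eaters t' := by
    funext j
    exact filter_congr fun v _ => h v j
  have hlen : s.stepLength t = s.stepLength t' := by
    simp only [EatingState.stepLength, heaters]
  simp only [EatingState.step, heaters, hlen, h]

theorem EatingState.Valid.step_of_time_eq_one {s : EatingState N M} (hs : s.Valid S)
    (h : s.time = 1) (t : N → Pref M) : s.step t = s := by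
  have hlen : s.stepLength t = 0 :=
    le_antisymm ((s.stepLength_le t).trans (by rw [h, sub_self]))
      (EatingState.stepLength_nonneg t hs)
  simp [EatingState.step, hlen]

theorem eatingState_available_antitone (S : Setting N M) (t : N → Pref M) :
    Antitone fun k => (eatingState S t k).available := by
  refine antitone_nat_of_succ_le fun k j hj => ?_
  rw [eatingState_succ] at hj
  exact lt_of_lt_of_le hj <| sub_le_self _ <| mul_nonneg (Nat.cast_nonneg _) <|
    EatingState.stepLength_nonneg t (eatingState_valid S t k)

theorem eatingState_share_mono (S : Setting N M) (t : N → Pref M) (v : N) (j : M) :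
    Monotone fun k => (eatingState S t k).share v j := by
  refine monotone_nat_of_le_succ fun k => ?_
  have hlen := EatingState.stepLength_nonneg t (eatingState_valid S t k)
  simp only [eatingState_succ, EatingState.step]
  split_ifs <;> linarith

theorem EatingState.share_step_of_not_isFavorite {s : EatingState N M}
    (h : ¬IsFavorite (t v) s.available j) : (s.step t).share v j = s.share v j := by
  simp [EatingState.step, h]

theorem eatingState_share_of_notMem_available (hj : j ∉ (eatingState S t k).available)
    (hkl : k ≤ l) : (eatingState S t l).share v j = (eatingState S t k).share v j := by
  induction l, hkl using Nat.le_induction with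
  | base => rfl
  | succ l hkl ih =>
    rw [eatingState_succ, EatingState.share_step_of_not_isFavorite fun hfav =>
      hj (eatingState_available_antitone S t hkl hfav.1), ih]

theorem exists_isFavorite_of_eatingState_share_ne_zero
    (h : (eatingState S t k).share v j ≠ 0) :
    ∃ l < k, IsFavorite (t v) (eatingState S t l).available j := by
  induction k with
  | zero => exact absurd rfl h
  | succ k ih =>
    by_cases hfav : IsFavorite (t v) (eatingState S t k).available j
    · exact ⟨k, k.lt_succ_self, hfav⟩
    · rw [eatingState_succ, EatingState.share_step_of_not_isFavorite hfav] at h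
      obtain ⟨l, hl, hl'⟩ := ih h
      exact ⟨l, hl.trans k.lt_succ_self, hl'⟩

end Eating

section EatingMatching

variable {N M : Type*} [Fintype N] [Fintype M] {S : Setting N M} {s : EatingState N M}

open Classical in
/-- Agent `i` has eaten less than one unit and every other agent at most one unit, so that the
agents other than `i` that have eaten from `J` are at least as many as the copies in `J`. -/
theorem EatingState.Valid.sum_cap_le_card (hs : s.Valid S) (htime : s.time < 1) (i : N)
    {J : Finset M} (hJ : ∀ j ∈ J, j ∉ s.available) :
    ∑ j ∈ J, S.cap j ≤ #{v | v ≠ i ∧ ∃ j ∈ J, s.share v j ≠ 0} := by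
  have hcap : ∀ j ∈ J, (S.cap j : ℝ) = ∑ v, s.share v j := fun j hj => by
    rw [← hs.rem_add, le_antisymm (not_lt.1 (hJ j hj)) (hs.rem_nonneg j), zero_add]
  have heaten : ∀ v, ∑ j ∈ J, s.share v j ≤ s.time := fun v =>
    hs.sum_share v ▸ sum_le_univ_sum_of_nonneg fun j => hs.share_nonneg v j
  have hbound : ∀ v, ∑ j ∈ J, s.share v j ≤
      (if v = i then s.time else 0) + if v ≠ i ∧ ∃ j ∈ J, s.share v j ≠ 0 then 1 else 0 := by
    intro v
    by_cases hvi : v = i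
    · simpa [hvi] using heaten i
    · by_cases hv : ∃ j ∈ J, s.share v j ≠ 0
      · rw [if_neg hvi, if_pos ⟨hvi, hv⟩, zero_add]
        exact (heaten v).trans hs.time_le
      · rw [if_neg hvi, if_neg fun h => hv h.2, zero_add]
        push Not at hv
        exact (sum_eq_zero hv).le
  have htotal : ∑ j ∈ J, (S.cap j : ℝ) ≤
      s.time + #{v | v ≠ i ∧ ∃ j ∈ J, s.share v j ≠ 0} := by
    rw [sum_congr rfl hcap, sum_comm]
    refine (sum_le_sum fun v _ => hbound v).trans_eq ?_
    rw [sum_add_distrib, sum_ite_eq' univ, if_pos (mem_univ i), sum_boole]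
  refine Nat.lt_succ_iff.1 ?_
  rify
  linarith

theorem EatingState.Valid.exists_injective (hs : s.Valid S) (htime : s.time < 1) (i : N) :
    ∃ F : (Σ j : {j // j ∉ s.available}, Fin (S.cap j)) → N, Injective F ∧
      ∀ x, F x ≠ i ∧ s.share (F x) x.1 ≠ 0 := by
  classical
  suffices hall : ∀ A : Finset (Σ j : {j // j ∉ s.available}, Fin (S.cap j)),
      #A ≤ #(A.biUnion fun x => {v | v ≠ i ∧ s.share v x.1 ≠ 0}) by
    simpa using (all_card_le_biUnion_card_iff_exists_injective _).1 hall
  intro A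
  set J := A.image fun x => (x.1 : M) with hJ
  calc #A ≤ ∑ j ∈ J, #{x ∈ A | (x.1 : M) = j} :=
        (card_eq_sum_card_image _ _).le
    _ ≤ ∑ j ∈ J, S.cap j := sum_le_sum fun j hj => ?_
    _ ≤ #{v | v ≠ i ∧ ∃ j ∈ J, s.share v j ≠ 0} :=
        hs.sum_cap_le_card htime i fun j hj => by
          obtain ⟨x, -, rfl⟩ := mem_image.1 hj
          exact x.1.2
    _ = #(A.biUnion fun x => {v | v ≠ i ∧ s.share v x.1 ≠ 0}) := congrArg card ?_
  · obtain ⟨x, -, rfl⟩ := mem_image.1 hj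
    rw [← card_fin (S.cap x.1)]
    refine card_le_card_of_surjOn (Sigma.mk (β := fun j => Fin (S.cap j.1)) x.1) ?_
    rintro ⟨k, n⟩ hk
    obtain rfl := Subtype.ext (mem_filter.1 hk).2
    exact ⟨n, by simp⟩
  · ext v
    simp only [hJ, mem_filter, mem_univ, true_and, mem_biUnion, exists_mem_image]
    exact ⟨fun ⟨hv, x, hx, hne⟩ => ⟨x, hx, hv, hne⟩, fun ⟨x, hx, hv, hne⟩ => ⟨hv, x, hx, hne⟩⟩

open Classical in
theorem EatingState.Valid.exists_matching (hs : s.Valid S) (htime : s.time < 1) (i : N) :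
    ∃ σ : N → M, σ i ∈ s.available ∧ (∀ v, σ v ∉ s.available → s.share v (σ v) ≠ 0) ∧
      ∀ j ∉ s.available, #{v | σ v = j} = S.cap j := by
  obtain ⟨c, hc⟩ : s.available.Nonempty := by
    by_contra hempty
    exact htime.ne (hs.time_eq i hempty)
  obtain ⟨F, hF, hFi⟩ := hs.exists_injective htime i
  set σ : N → M := extend F (fun x => x.1) fun _ => c with hσ
  have hrange : ∀ v, σ v ∉ s.available → ∃ x, F x = v := fun v hv => by
    by_contra hx
    exact hv (by rwa [hσ, extend_apply' _ _ _ hx])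
  have happly : ∀ x, σ (F x) = x.1 := hF.extend_apply _ _
  refine ⟨σ, ?_, fun v hv => ?_, fun j hj => ?_⟩
  · rwa [hσ, extend_apply' _ _ _ fun ⟨x, hx⟩ => (hFi x).1 hx]
  · obtain ⟨x, rfl⟩ := hrange v hv
    exact happly x ▸ (hFi x).2
  · have hfiber : ({v | σ v = j} : Finset N) =
        univ.image fun n : Fin (S.cap j) => F ⟨⟨j, hj⟩, n⟩ := by
      ext v
      simp only [mem_filter, mem_univ, true_and, mem_image]
      refine ⟨fun hv => ?_, ?_⟩
      · obtain ⟨x, rfl⟩ := hrange v (hv ▸ hj)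
        rw [happly] at hv
        subst hv
        exact ⟨x.2, rfl⟩
      · rintro ⟨n, rfl⟩
        exact happly _
    have hinj : Injective fun n : Fin (S.cap j) => F ⟨⟨j, hj⟩, n⟩ :=
      hF.comp sigma_mk_injective
    rw [hfiber, card_image_of_injective _ hinj, card_univ, Fintype.card_fin]

/-- Each object gets as its priority the number of steps after which it is exhausted. -/
theorem exists_ordering_of_eatingState {t : N → Pref M} {k : ℕ}
    (htime : (eatingState S t k).time < 1) (i : N) :
    ∃ π : Fin (Fintype.card N) ≃ N, remainingObjects S t π i = (eatingState S t k).available := by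
  classical
  have hanti := eatingState_available_antitone S t
  have hv := eatingState_valid S t k
  obtain ⟨σ, hσi, hσeat, hσcap⟩ := hv.exists_matching htime i
  set e : M → ℕ∞ := fun j =>
    if j ∈ (eatingState S t k).available then ⊤
    else #{l ∈ range k | j ∈ (eatingState S t l).available} with he
  have htop : ∀ j, e j = ⊤ ↔ j ∈ (eatingState S t k).available := fun j => by simp [he]
  have hpref : ∀ v, e (σ v) ≠ ⊤ → ∀ j, t v j < t v (σ v) → e j < e (σ v) := by
    intro v hσv j hj
    rw [Ne, htop] at hσv
    obtain ⟨l, hl, hfav⟩ := exists_isFavorite_of_eatingState_share_ne_zero (hσeat v hσv)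
    have hjl : j ∉ (eatingState S t l).available := hfav.notMem_of_lt hj
    have hjk : j ∉ (eatingState S t k).available := fun h => hjl (hanti hl.le h)
    simp only [he, if_neg hσv, if_neg hjk, Nat.cast_lt]
    refine card_lt_card ((ssubset_iff_of_subset fun n hn => ?_).2
      ⟨l, by simp [hl, hfav.1], by simp [hjl]⟩)
    rw [mem_filter] at hn ⊢
    exact ⟨hn.1, hanti (not_lt.1 fun hln => hjl (hanti hln.le hn.2)) hfav.1⟩
  have hcap : ∀ j ∈ (eatingState S t k).available, 0 < S.cap j := fun j hj => by
    have : (0 : ℝ) < S.cap j := hv.rem_add j ▸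
      add_pos_of_pos_of_nonneg hj (sum_nonneg fun v _ => hv.share_nonneg v j)
    exact_mod_cast this
  obtain ⟨π, hπ⟩ := exists_ordering_remainingObjects_eq
    (fun j hj => hσcap j ((htop j).not.1 hj)) hpref ((htop _).2 hσi)
  refine ⟨π, hπ.trans (Set.ext fun j => ?_)⟩
  rw [Set.mem_ofPred_eq, htop, and_iff_left_iff_imp]
  exact hcap j

end EatingMatching

section ProbabilisticSerial

variable {N M : Type*} [Fintype N] [Fintype M] [DecidableEq N] [DecidableEq M] {S : Setting N M}
  {t : N → Pref M} {i : N} {t' : Pref M} {a b : M} {k : ℕ}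

theorem Pref.IsAdjacentSwap.eatingState_update (h : (t i).IsAdjacentSwap t' a b)
    (hk : ∀ l < k, (eatingState S t l).time < 1 →
      ¬(IsFavorite (t i) (eatingState S t l).available a ∧ b ∈ (eatingState S t l).available)) :
    eatingState S (update t i t') k = eatingState S t k := by
  induction k with
  | zero => rfl
  | succ k ih =>
    rw [eatingState_succ, eatingState_succ, ih fun l hl => hk l (hl.trans k.lt_succ_self)]
    have hv := eatingState_valid S t k
    rcases hv.time_le.lt_or_eq with htime | htime
    · refine EatingState.step_congr fun v j => ?_
      rcases eq_or_ne v i with rfl | hvi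
      · rw [update_self, h.isFavorite_iff (hk k k.lt_succ_self htime)]
      · rw [update_of_ne hvi]
    · rw [hv.step_of_time_eq_one htime, hv.step_of_time_eq_one htime]

/-- The runs of the two profiles agree until agent `i` eats from `a` while `b` is available; from
then on the objects above `a` are exhausted. -/
theorem PS_weaklyInvariant (S : Setting N M) : (PS S).WeaklyInvariant := by
  classical
  intro i t t' a b h j hj
  change (eatingState S t (Fintype.card M)).share i j =
    (eatingState S (update t i t') (Fintype.card M)).share i j
  by_cases hex : ∃ k < Fintype.card M,
      IsFavorite (t i) (eatingState S t k).available a ∧ b ∈ (eatingState S t k).available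
  · obtain ⟨hkm, hka, -⟩ := Nat.find_spec hex
    have hsame : eatingState S (update t i t') (Nat.find hex) = eatingState S t (Nat.find hex) :=
      h.eatingState_update fun l hl _ hc => Nat.find_min hex hl ⟨hl.trans hkm, hc⟩
    have hjk := hka.notMem_of_lt hj
    rw [eatingState_share_of_notMem_available hjk hkm.le,
      eatingState_share_of_notMem_available (hsame ▸ hjk) hkm.le, hsame]
  · rw [h.eatingState_update fun l hl _ hc => hex ⟨l, hl, hc⟩]

theorem PS_weaklyLessVarying (S : Setting N M) : (PS S).WeaklyLessVarying (RSD S) := by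
  rintro i t t' ⟨a, b, h⟩ hne
  obtain ⟨k, htime, ha, hb⟩ : ∃ k, (eatingState S t k).time < 1 ∧
      IsFavorite (t i) (eatingState S t k).available a ∧ b ∈ (eatingState S t k).available := by
    by_contra! hno
    refine hne (congrArg (fun s : EatingState N M => s.share i) ?_).symm
    exact h.eatingState_update fun l _ htime hc => hno l htime hc.1 hc.2
  obtain ⟨π, hπ⟩ := exists_ordering_of_eatingState htime i
  rw [← hπ] at ha hb
  exact fun heq => (RSD_prob_lt_of_isAdjacentSwap h ha hb).ne (congrFun heq a).symm

end ProbabilisticSerial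

section OrdinalEfficiency

variable {N M : Type*} [Fintype N] [Fintype M] {S : Setting N M} {t : N → Pref M}
  {x : Allocation S} {k : ℕ} {j : M}

theorem Allocation.prob_eq_zero_of_cap_eq_zero (x : Allocation S) (hj : S.cap j = 0) (v : N) :
    x.prob v j = 0 := by
  have hsum : ∑ v, x.prob v j = 0 :=
    le_antisymm (by simpa [hj] using x.capacity j) (sum_nonneg fun v _ => (x.mem_Icc v j).1)
  exact (sum_eq_zero_iff_of_nonneg fun v _ => (x.mem_Icc v j).1).1 hsum v (mem_univ v)

theorem sum_PS_prob_of_notMem_available (hk : k ≤ Fintype.card M)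
    (hj : j ∉ (eatingState S t k).available) : ∑ v, (PS S t).prob v j = S.cap j := by
  have hv := eatingState_valid S t (Fintype.card M)
  have hrem : (eatingState S t (Fintype.card M)).rem j = 0 :=
    le_antisymm (not_lt.1 fun h => hj (eatingState_available_antitone S t hk h)) (hv.rem_nonneg j)
  rw [← hv.rem_add j, hrem, zero_add]
  rfl

/-- An agent that eats from `j` has no access to better objects, which were exhausted before and
hence are allocated as in `PS S t`; it therefore gets at least as much of `j` under `x`. As `j` is
exhausted too, no agent can get more. -/
theorem OrdDominates.prob_eq_PS_of_notMem_available (h : OrdDominates t x (PS S t))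
    (hk : k ≤ Fintype.card M) (hj : j ∉ (eatingState S t k).available) (v : N) :
    x.prob v j = (PS S t).prob v j := by
  have hanti := eatingState_available_antitone S t
  induction k generalizing j v with
  | zero =>
    have hcap : S.cap j = 0 := by simpa [eatingState, EatingState.init, EatingState.available]
      using hj
    rw [x.prob_eq_zero_of_cap_eq_zero hcap, (PS S t).prob_eq_zero_of_cap_eq_zero hcap]
  | succ k ih =>
    have hle : ∀ v, (PS S t).prob v j ≤ x.prob v j := fun v => by
      by_cases hzero : (PS S t).prob v j = 0
      · exact hzero ▸ (x.mem_Icc v j).1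
      · obtain ⟨l, -, hfav⟩ := exists_isFavorite_of_eatingState_share_ne_zero hzero
        have hlk : l ≤ k := by
          by_contra! hkl
          exact hj (hanti hkl hfav.1)
        refine (h v).apply_le (by rw [x.fulfillment, (PS S t).fulfillment]) ?_
        simp only [upperWeight_eq_sum_ite]
        refine sum_congr rfl fun c _ => ite_congr rfl (fun hc => ?_) fun _ => rfl
        exact ih (by omega) (fun hck => hfav.notMem_of_lt hc (hanti hlk hck)) v
    have hsum : ∑ v, (PS S t).prob v j = ∑ v, x.prob v j :=
      le_antisymm (sum_le_sum fun v _ => hle v)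
        (sum_PS_prob_of_notMem_available hk hj ▸ x.capacity j)
    exact ((sum_eq_sum_iff_of_le fun v _ => hle v).1 hsum v (mem_univ v)).symm

theorem PS_prob_eq_zero_of_lt {c : M} {v : N}
    (hc : c ∈ (eatingState S t (Fintype.card M)).available) (hcj : t v c < t v j) :
    (PS S t).prob v j = 0 := by
  by_contra hne
  obtain ⟨k, hk, hfav⟩ := exists_isFavorite_of_eatingState_share_ne_zero hne
  exact hfav.notMem_of_lt hcj (eatingState_available_antitone S t hk.le hc)

theorem OrdDominates.PS_ordDominates (h : OrdDominates t x (PS S t)) :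
    OrdDominates t (PS S t) x := by
  intro v b
  by_cases hex : ∃ c ∈ (eatingState S t (Fintype.card M)).available, t v c < t v b
  · obtain ⟨c, hc, hcb⟩ := hex
    calc upperWeight (t v) (x.prob v) b ≤ ∑ j, x.prob v j := by
          rw [upperWeight_eq_sum_ite]
          refine sum_le_sum fun j _ => ?_
          split_ifs
          exacts [le_rfl, (x.mem_Icc v j).1]
      _ = ∑ j, (PS S t).prob v j := by rw [x.fulfillment, (PS S t).fulfillment]
      _ = upperWeight (t v) ((PS S t).prob v) b := by
          rw [upperWeight_eq_sum_ite]
          refine sum_congr rfl fun j _ => ?_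
          split_ifs with hj
          exacts [rfl, PS_prob_eq_zero_of_lt hc (hcb.trans_le (not_lt.1 hj))]
  · push Not at hex
    simp only [upperWeight_eq_sum_ite]
    refine (sum_congr rfl fun c _ => ite_congr rfl (fun hc => ?_) fun _ => rfl).le
    exact h.prob_eq_PS_of_notMem_available le_rfl (fun hcm => (hex c hcm).not_gt hc) v

theorem PS_imperfectOrdDominates (f : Mechanism S) : ImperfectOrdDominates (PS S) f :=
  fun _ ht => ht.elim id OrdDominates.PS_ordDominates

end OrdinalEfficiency

section Example

variable {N M : Type*} [Fintype N] [Fintype M]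

open Classical in
/-- No object is exhausted before time `τ`, so that the first step lasts at least until `τ`. -/
theorem le_PS_prob_of_isFavorite {S : Setting N M} {t : N → Pref M} {τ : ℝ} (hτ : τ ≤ 1)
    (hcap : ∀ j, τ * #{v | IsFavorite (t v) {l | 0 < S.cap l} j} ≤ S.cap j) {i : N} {j : M}
    (hj : IsFavorite (t i) {l | 0 < S.cap l} j) : τ ≤ (PS S t).prob i j := by
  have havail : (EatingState.init S).available = {l | 0 < S.cap l} := by
    simp [EatingState.init, EatingState.available]
  have hlen : τ ≤ (EatingState.init S).stepLength t := by
    rcases (EatingState.init S).stepLength_cases t with h | ⟨c, hc, h⟩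
    · rw [h, EatingState.init, sub_zero]
      exact hτ
    · rw [h, le_div_iff₀ (by exact_mod_cast hc.card_pos), EatingState.eaters, havail]
      exact hcap c
  have hshare : (eatingState S t 1).share i j = (EatingState.init S).stepLength t := by
    rw [eatingState_succ]
    change 0 + (if IsFavorite (t i) (EatingState.init S).available j then _ else 0) = _
    rw [havail, if_pos hj, zero_add]
    rfl
  calc τ ≤ (eatingState S t 1).share i j := hlen.trans hshare.ge
    _ ≤ (PS S t).prob i j :=
      eatingState_share_mono S t i j (Fintype.card_pos_iff.2 ⟨j⟩)

/-- A version of `remainingCap` that can be evaluated: `remainingCap` is defined by case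
distinctions that are not decided constructively. -/
def computeRemainingCap (cap : M → ℕ) (t : N → Pref M) (π : Fin (Fintype.card N) ≃ N) :
    ℕ → M → ℕ
  | 0 => cap
  | k + 1 => fun j =>
      if ∃ h : k < Fintype.card N, 0 < computeRemainingCap cap t π k j ∧
          ∀ l, 0 < computeRemainingCap cap t π k l → t (π ⟨k, h⟩) j ≤ t (π ⟨k, h⟩) l
      then computeRemainingCap cap t π k j - 1 else computeRemainingCap cap t π k j

/-- The decidable form of the condition that agent `i` picks object `j` in the serial dictatorship
with ordering `π`. -/
abbrev ComputePicks (S : Setting N M) (t : N → Pref M) (i : N) (j : M)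
    (π : Fin (Fintype.card N) ≃ N) : Prop :=
  0 < computeRemainingCap S.cap t π (π.symm i) j ∧
    ∀ l, 0 < computeRemainingCap S.cap t π (π.symm i) l → t i j ≤ t i l

theorem remainingCap_eq_computeRemainingCap (S : Setting N M) (t : N → Pref M)
    (π : Fin (Fintype.card N) ≃ N) (k : ℕ) :
    remainingCap S t π k = computeRemainingCap S.cap t π k := by
  induction k with
  | zero => rfl
  | succ k ih =>
    ext j
    simp only [remainingCap, computeRemainingCap, ih, IsFavorite, Set.mem_ofPred_eq]

theorem RSD_prob_eq_card_div [DecidableEq N] (S : Setting N M) (t : N → Pref M) (i : N) (j : M)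
    [DecidablePred (ComputePicks S t i j)] :
    (RSD S t).prob i j = #{π | ComputePicks S t i j π} / (Fintype.card N).factorial := by
  simp only [RSD, serialDictatorship, remainingCap_eq_computeRemainingCap, IsFavorite,
    Set.mem_ofPred_eq, ← sum_boole]
  congr!

/-- The setting of the strictness example: four agents, two objects of capacity one and one object
of capacity two. -/
def fourAgentSetting : Setting (Fin 4) (Fin 3) where
  cap := ![1, 1, 2]
  supply := by decide

/-- The most preferred objects in `fourAgentProfile`. -/
def fourAgentFirst : Fin 4 → Fin 3 := ![0, 0, 1, 1]

/-- The profile of the strictness example: agents `0` and `1` prefer object `0` to `1`, agents `2`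
and `3` prefer `1` to `0`, and object `2` is the last choice of all of them. -/
def fourAgentProfile (i : Fin 4) : Pref (Fin 3) :=
  (Equiv.swap 0 (fourAgentFirst i)).trans (finCongr (Fintype.card_fin 3).symm)

theorem RSD_fourAgentProfile_first (i : Fin 4) :
    (RSD fourAgentSetting fourAgentProfile).prob i (fourAgentFirst i) = 5 / 12 := by
  have hcount : ∀ i,
      #{π | ComputePicks fourAgentSetting fourAgentProfile i (fourAgentFirst i) π} = 10 := by
    decide +kernel
  rw [RSD_prob_eq_card_div, hcount, Fintype.card_fin]
  norm_num [Nat.factorial]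

theorem RSD_fourAgentProfile_last (i : Fin 4) :
    (RSD fourAgentSetting fourAgentProfile).prob i 2 = 1 / 2 := by
  have hcount : ∀ i, #{π | ComputePicks fourAgentSetting fourAgentProfile i 2 π} = 12 := by
    decide +kernel
  rw [RSD_prob_eq_card_div, hcount, Fintype.card_fin]
  norm_num [Nat.factorial]

theorem isFavorite_fourAgentProfile_iff (i : Fin 4) (j : Fin 3) :
    IsFavorite (fourAgentProfile i) {l | 0 < fourAgentSetting.cap l} j ↔ j = fourAgentFirst i := by
  simp only [IsFavorite, Set.mem_ofPred_eq]
  revert i j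
  decide

theorem half_le_PS_fourAgentProfile_first (i : Fin 4) :
    1 / 2 ≤ (PS fourAgentSetting fourAgentProfile).prob i (fourAgentFirst i) := by
  refine le_PS_prob_of_isFavorite (by norm_num) (fun j => ?_)
    ((isFavorite_fourAgentProfile_iff i _).2 rfl)
  have hcap : ∀ j, #{v | j = fourAgentFirst v} ≤ 2 * fourAgentSetting.cap j := by decide
  have : (#{v | j = fourAgentFirst v} : ℝ) ≤ 2 * fourAgentSetting.cap j := by
    exact_mod_cast hcap j
  simp only [isFavorite_fourAgentProfile_iff]
  linarith

theorem upperWeight_fourAgentProfile (i : Fin 4) (v : Fin 3 → ℝ) (b : Fin 3) :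
    upperWeight (fourAgentProfile i) v b =
      if b = fourAgentFirst i then 0 else if b = 2 then v 0 + v 1 else v (fourAgentFirst i) := by
  have hlt : ∀ i j b, fourAgentProfile i j < fourAgentProfile i b ↔
      b ≠ fourAgentFirst i ∧ if b = 2 then j ≠ 2 else j = fourAgentFirst i := by
    decide
  rw [upperWeight_eq_sum_ite]
  simp only [hlt]
  by_cases hfirst : b = fourAgentFirst i
  · simp [hfirst]
  · by_cases hlast : b = 2
    · subst hlast
      simp [hfirst, Fin.sum_univ_three]
    · simp [hfirst, hlast]

theorem strictOrdDominates_fourAgentProfile :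
    StrictOrdDominates fourAgentProfile (PS fourAgentSetting fourAgentProfile)
      (RSD fourAgentSetting fourAgentProfile) := by
  have hlt : ∀ i, (RSD fourAgentSetting fourAgentProfile).prob i (fourAgentFirst i) <
      (PS fourAgentSetting fourAgentProfile).prob i (fourAgentFirst i) := fun i => by
    rw [RSD_fourAgentProfile_first]
    linarith [half_le_PS_fourAgentProfile_first i]
  refine ⟨fun i b => ?_, 0, 1, ?_⟩
  · rw [upperWeight_fourAgentProfile, upperWeight_fourAgentProfile]
    split_ifs
    · exact le_rfl
    · have hfirst : ∀ i, fourAgentFirst i = 0 ∨ fourAgentFirst i = 1 := by decide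
      have hsum := (RSD fourAgentSetting fourAgentProfile).fulfillment i
      rw [Fin.sum_univ_three, RSD_fourAgentProfile_last] at hsum
      have hhalf := half_le_PS_fourAgentProfile_first i
      have h0 := ((PS fourAgentSetting fourAgentProfile).mem_Icc i 0).1
      have h1 := ((PS fourAgentSetting fourAgentProfile).mem_Icc i 1).1
      rcases hfirst i with h | h <;> rw [h] at hhalf <;> linarith
    · exact (hlt i).le
  · simpa [upperWeight_fourAgentProfile, fourAgentFirst] using hlt 0

end Example

theorem RSD_PS_hybridAdmissible {N M : Type*} [Fintype N] [Fintype M] [DecidableEq N]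
    [DecidableEq M] (S : Setting N M) : HybridAdmissible (RSD S) (PS S) where
  strategyproof := RSD_strategyproof S
  weaklyInvariant := PS_weaklyInvariant S
  weaklyLessVarying := PS_weaklyLessVarying S

theorem PS_strictImperfectOrdDominates_RSD_fourAgentSetting :
    StrictImperfectOrdDominates (PS fourAgentSetting) (RSD fourAgentSetting) :=
  ⟨PS_imperfectOrdDominates _, fourAgentProfile, strictOrdDominates_fourAgentProfile⟩

theorem mainTheorem11 :
    (∀ {N : Type*} {M : Type*} [Fintype N] [Fintype M] [DecidableEq N] [DecidableEq M]
      (S : Setting N M),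
      HybridAdmissible (RSD S) (PS S) ∧
      (∀ (β : ℝ) (hβ : β ∈ Set.Ioc (0 : ℝ) 1),
        ImperfectOrdDominates (hybrid β (Set.Ioc_subset_Icc_self hβ) (RSD S) (PS S)) (RSD S) ∧
        ((∃ t, StrictOrdDominates t (PS S t) (RSD S t)) →
          StrictImperfectOrdDominates
            (hybrid β (Set.Ioc_subset_Icc_self hβ) (RSD S) (PS S)) (RSD S))) ∧
      (∀ r ∈ Set.Ico (0 : ℝ) 1, ∃ (β : ℝ) (hβ : β ∈ Set.Ioo (0 : ℝ) 1),
        Mechanism.PartiallyStrategyproof r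
          (hybrid β (Set.Ioo_subset_Icc_self hβ) (RSD S) (PS S)) ∧
        ImperfectOrdDominates (hybrid β (Set.Ioo_subset_Icc_self hβ) (RSD S) (PS S)) (RSD S))) ∧
    (∃ (n m : ℕ) (S : Setting (Fin n) (Fin m)),
      StrictImperfectOrdDominates (PS S) (RSD S) ∧
      ∀ r ∈ Set.Ico (0 : ℝ) 1, ∃ (β : ℝ) (hβ : β ∈ Set.Ioo (0 : ℝ) 1),
        Mechanism.PartiallyStrategyproof r
          (hybrid β (Set.Ioo_subset_Icc_self hβ) (RSD S) (PS S)) ∧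
        StrictImperfectOrdDominates
          (hybrid β (Set.Ioo_subset_Icc_self hβ) (RSD S) (PS S)) (RSD S)) := by
  refine ⟨fun S => ⟨RSD_PS_hybridAdmissible S, fun β hβ => ⟨?_, fun hstrict => ?_⟩,
    fun r hr => ?_⟩, 4, 3, fourAgentSetting, ?_, fun r hr => ?_⟩
  · exact (PS_imperfectOrdDominates _).hybrid (Set.Ioc_subset_Icc_self hβ) hβ.1
  · exact StrictImperfectOrdDominates.hybrid ⟨PS_imperfectOrdDominates _, hstrict⟩
      (Set.Ioc_subset_Icc_self hβ) hβ.1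
  · obtain ⟨β, hβ, hsp⟩ :=
      (RSD_PS_hybridAdmissible S).exists_partiallyStrategyproof_hybrid hr.2
    exact ⟨β, hβ, hsp, (PS_imperfectOrdDominates _).hybrid (Set.Ioo_subset_Icc_self hβ) hβ.1⟩
  · exact PS_strictImperfectOrdDominates_RSD_fourAgentSetting
  · obtain ⟨β, hβ, hsp⟩ :=
      (RSD_PS_hybridAdmissible fourAgentSetting).exists_partiallyStrategyproof_hybrid hr.2
    exact ⟨β, hβ, hsp, PS_strictImperfectOrdDominates_RSD_fourAgentSetting.hybrid
      (Set.Ioo_subset_Icc_self hβ) hβ.1⟩
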